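/- All systems are finite-dimensional; $\ln$ is the natural logarithm, $S(\rho)=-\mathrm{tr}(\rho\ln\rho)$, $I(A:B)_\Psi=S(\Psi_A)+S(\Psi_B)-S(\Psi_{AB})$, and $\|\Phi-\Psi\|_\diamond=\sup_{\psi}\|(\Phi\otimes\mathrm{id}_R)(\psi)-(\Psi\otimes\mathrm{id}_R)(\psi)\|_1$, the supremum being over all finite-dimensional references $R$ and all states $\psi$ of the input and $R$. **Circuits and complexity.** Fix a gate set of unitaries on qubits. A circuit adjoins ancillas in the state $|0\rangle$, applies gates of the set to chosen wires, and traces out all wires but its output wires; its size is its number of gates. The complexity $\mathcal C_\kappa(\Phi)\in\mathbb N\cup\{\infty\}$ of a channel $\Phi$ between qubit registers is the least size of a circuit that implements it up to error $\kappa$ in diamond norm. An algorithm is a channel from a qubit register to one classical bit; it is implemented by a circuit with one output qubit that is then measured in the computational basis, and its complexity $\mathcal C_\kappa$ is defined in the same way. Let $$D_t(\rho,\sigma)=\sup_{\mathcal A:\ \mathcal C_\kappa(\mathcal A)\le t}\bigl|\Pr[\mathcal A(\rho)=1]-\Pr[\mathcal A(\sigma)=1]\bigr|,\qquad \|\Phi-\Psi\|_t=\sup_{\psi}D_t\bigl((\Phi\otimes\mathrm{id}_R)(\psi),(\Psi\otimes\mathrm{id}_R)(\psi)\bigr),$$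 where the last supremum is over all qubit registers $R$ of any size and all states $\psi$ of the input and $R$, and where $\kappa$ is the fixed error constant of the complexity of algorithms. **CDQS.** Let $f:\{0,1\}^n\times\{0,1\}^n\to\{0,1\}$ and let $Q$ be a secret system of dimension $d_Q\ge1$, with its basis encoded injectively into the bit strings of some length $q$. In a CDQS protocol Alice and Bob share a state $\Psi_{AB}$; on input $x$ Alice applies a channel $\mathcal N^x_{QA\to M_a}$, on input $y$ Bob applies a channel $\mathcal N^y_{B\to M_b}$, and the referee receives the qubit registers $M=M_aM_b$. Write $\mathcal N^{x,y}_{Q\to M}(\rho)=(\mathcal N^x\otimes\mathcal N^y)(\rho\otimes\Psi_{AB})$. * The protocol is *$\epsilon$-correct* with decoders of size $s$ (up to implementation error $\kappa_D$) if for all $(x,y)$ with $f(x,y)=1$ there is a channel $\mathcal D^{x,y}_{M\to Q}$ that, with its output encoded into $q$ qubits, has $\mathcal C_{\kappa_D}\le s$, and that satisfies $\|\mathcal D^{x,y}\circ\mathcal N^{x,y}-\mathcal I_Q\|_\diamond\le\epsilon$. * It is *$\delta$-secure* against complexity $t$ if for all $(x,y)$ with $f(x,y)=0$ there is a channel $\mathcal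 S^{x,y}_{\varnothing\to M}$ with $\|\mathcal S^{x,y}\circ\mathrm{tr}_Q-\mathcal N^{x,y}\|_t\le\delta$. **Theorem.** Let $f$ be such that $f(x_*,\cdot)$ is non-constant for some $x_*$. Suppose that a CDQS protocol for $f$ with a $d_Q$-dimensional secret and resource state $\Psi_{AB}$ is $\epsilon$-correct with decoders of size $s$ (up to implementation error $\kappa_D$) and $\delta$-secure against complexity $t$. Suppose also that $$t\ \ge\ s+\mathcal C_{\kappa_T}(\mathcal T),\qquad \kappa_D+\kappa_T\le\kappa,$$ where $\mathcal T$ is the algorithm that measures $\{P,1-P\}$ on two $q$-qubit registers, $P$ being the projector onto the maximally entangled state of two encoded copies of $Q$, and outputs $1$ on the outcome $P$. Then $$I(A:B)_\Psi\ \ge\ -\ln\Bigl(\frac1{\sqrt{d_Q}}+\delta+\epsilon\Bigr)-1 .$$ -/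

import Mathlib

open scoped ComplexOrder Kronecker

noncomputable section

namespace CDQS

/-! ## States and entropy of finite-dimensional quantum systems

A system is given by a finite type indexing an orthonormal basis; operators are matrices. -/

/-- A density matrix. -/
structure State (a : Type*) [Fintype a] [DecidableEq a] where
  mat : Matrix a a ℂ
  posSemidef : mat.PosSemidef
  trace_one : mat.trace = 1

/-- The von Neumann entropy `-tr (ρ ln ρ)`, evaluated on the spectrum of `ρ`. -/
def State.entropy {a : Type*} [Fintype a] [DecidableEq a] (ρ : State a) : ℝ :=
  ∑ i, Real.negMulLog (ρ.posSemidef.isHermitian.eigenvalues i)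

/-- The marginal on the first factor (partial trace over the second one). -/
def State.fst {a b : Type*} [Fintype a] [DecidableEq a] [Fintype b] [DecidableEq b]
    (ρ : State (a × b)) : State a where
  mat := ∑ k : b, ρ.mat.submatrix (fun i => (i, k)) (fun i => (i, k))
  posSemidef := Matrix.posSemidef_sum _ fun _ _ => ρ.posSemidef.submatrix _
  trace_one := by
    rw [← ρ.trace_one]
    simp only [Matrix.trace, Matrix.diag, Matrix.sum_apply, Matrix.submatrix_apply,
      Fintype.sum_prod_type]

/-- The marginal on the second factor (partial trace over the first one). -/
def State.snd {a b : Type*} [Fintype a] [DecidableEq a] [Fintype b] [DecidableEq b]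
    (ρ : State (a × b)) : State b where
  mat := ∑ k : a, ρ.mat.submatrix (fun i => (k, i)) (fun i => (k, i))
  posSemidef := Matrix.posSemidef_sum _ fun _ _ => ρ.posSemidef.submatrix _
  trace_one := by
    rw [← ρ.trace_one]
    simp only [Matrix.trace, Matrix.diag, Matrix.sum_apply, Matrix.submatrix_apply,
      Fintype.sum_prod_type]
    exact Finset.sum_comm

/-- The mutual information `I(A:B) = S(A) + S(B) - S(AB)`. -/
def State.mutualInfo {a b : Type*} [Fintype a] [DecidableEq a] [Fintype b] [DecidableEq b]
    (ρ : State (a × b)) : ℝ :=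
  ρ.fst.entropy + ρ.snd.entropy - ρ.entropy

/-! ## Channels -/

/-- Linear maps taking operators on the system `a` to operators on the system `b`. -/
abbrev OpMap (a b : Type*) := Matrix a a ℂ →ₗ[ℂ] Matrix b b ℂ

/-- `Φ ⊗ id` with an extra system `r` on the right. -/
def amplR {a b : Type*} (r : Type*) (Φ : OpMap a b) : OpMap (a × r) (b × r) where
  toFun X := Matrix.of fun i j =>
    Φ (X.submatrix (fun k => (k, i.2)) (fun k => (k, j.2))) i.1 j.1
  map_add' X Y := by ext i j; simp [Matrix.submatrix_add]
  map_smul' c X := by ext i j; simp [Matrix.submatrix_smul]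

/-- `id ⊗ Φ` with an extra system `r` on the left. -/
def amplL {a b : Type*} (r : Type*) (Φ : OpMap a b) : OpMap (r × a) (r × b) where
  toFun X := Matrix.of fun i j =>
    Φ (X.submatrix (fun k => (i.1, k)) (fun k => (j.1, k))) i.2 j.2
  map_add' X Y := by ext i j; simp [Matrix.submatrix_add]
  map_smul' c X := by ext i j; simp [Matrix.submatrix_smul]

/-- The tensor product `Φ ⊗ Ψ`. -/
def tensorMap {a b c e : Type*} (Φ : OpMap a b) (Ψ : OpMap c e) : OpMap (a × c) (b × e) :=
  amplL b Ψ ∘ₗ amplR c Φ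

/-- A quantum channel: a completely positive trace-preserving linear map. -/
structure Channel (a b : Type*) [Fintype a] [DecidableEq a] [Fintype b] [DecidableEq b] where
  map : OpMap a b
  completelyPositive : ∀ (r : ℕ) (X : Matrix (a × Fin r) (a × Fin r) ℂ),
    X.PosSemidef → (amplR (Fin r) map X).PosSemidef
  tracePreserving : ∀ X, (map X).trace = X.trace

/-- The trace norm: the sum of the singular values. -/
def traceNorm {a : Type*} [Fintype a] [DecidableEq a] (X : Matrix a a ℂ) : ℝ :=
  ∑ i, √((Matrix.isHermitian_conjTranspose_mul_self X).eigenvalues i)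

/-- The diamond norm distance, a supremum over reference systems of all finite dimensions and
all joint states of the input and the reference. -/
def diamondDist {a b : Type*} [Fintype a] [DecidableEq a] [Fintype b] [DecidableEq b]
    (Φ Ψ : OpMap a b) : EReal :=
  ⨆ (r : ℕ) (ψ : State (a × Fin r)),
    ((traceNorm (amplR (Fin r) Φ ψ.mat - amplR (Fin r) Ψ ψ.mat) : ℝ) : EReal)

/-- Relabelling of the basis of a system along a bijection. -/
def relabel {a b : Type*} (e : a ≃ b) : OpMap a b :=
  (Matrix.reindexLinearEquiv ℂ ℂ e e).toLinearMap

/-! ## Qubit circuits -/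

/-- The computational basis of the qubit register with wires `W`. -/
abbrev Reg (W : Type) := W → Bool

/-- Two registers side by side form one register. -/
def joinReg (V W : Type) : Reg V × Reg W ≃ Reg (V ⊕ W) :=
  (Equiv.sumArrowEquivProdArrow V W Bool).symm

/-- A gate set: a collection of unitaries, each acting on some number of qubits. -/
structure GateSet where
  Gate : Type
  arity : Gate → ℕ
  mat : (g : Gate) → Matrix (Reg (Fin (arity g))) (Reg (Fin (arity g))) ℂ
  unitary : ∀ g, mat g ∈ Matrix.unitaryGroup (Reg (Fin (arity g))) ℂ

open Classical in
/-- The operator `U` applied to the wires `p`, and the identity on all other wires. -/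
def placeGate {k : ℕ} {W : Type} (U : Matrix (Reg (Fin k)) (Reg (Fin k)) ℂ) (p : Fin k ↪ W) :
    Matrix (Reg W) (Reg W) ℂ :=
  Matrix.of fun s t => if ∀ w, w ∉ Set.range p → s w = t w then U (s ∘ p) (t ∘ p) else 0

/-- A circuit from the register `I` to the register `O`: it adjoins `anc` ancilla qubits in the
state `|0⟩`, applies the listed gates (the head of the list first), and keeps only the wires
`out`, tracing out all others. -/
structure Circuit (G : GateSet) (I O : Type) where
  anc : ℕ
  gates : List ((g : G.Gate) × (Fin (G.arity g) ↪ I ⊕ Fin anc))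
  out : O ↪ I ⊕ Fin anc

namespace Circuit

variable {G : GateSet} {I O : Type} [Fintype I] [DecidableEq I] [Fintype O] [DecidableEq O]

/-- The number of gates. -/
def size (c : Circuit G I O) : ℕ := c.gates.length

/-- The unitary performed by the gates on all wires. -/
def unitary (c : Circuit G I O) : Matrix (Reg (I ⊕ Fin c.anc)) (Reg (I ⊕ Fin c.anc)) ℂ :=
  c.gates.foldl (fun U g => placeGate (G.mat g.1) g.2 * U) 1

open Classical in
/-- `X ⊗ |0⟩⟨0|` on the input and the ancillas. -/
def initial (c : Circuit G I O) (X : Matrix (Reg I) (Reg I) ℂ) :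
    Matrix (Reg (I ⊕ Fin c.anc)) (Reg (I ⊕ Fin c.anc)) ℂ :=
  Matrix.of fun s t =>
    if ∀ k : Fin c.anc, s (Sum.inr k) = false ∧ t (Sum.inr k) = false
    then X (fun i => s (Sum.inl i)) (fun i => t (Sum.inl i)) else 0

open Classical in
/-- The partial trace over all wires except the output wires. -/
def restrict (c : Circuit G I O)
    (Y : Matrix (Reg (I ⊕ Fin c.anc)) (Reg (I ⊕ Fin c.anc)) ℂ) :
    Matrix (Reg O) (Reg O) ℂ :=
  Matrix.of fun u v => ∑ s, ∑ t,
    if s ∘ c.out = u ∧ t ∘ c.out = v ∧ ∀ w, w ∉ Set.range c.out → s w = t w then Y s t else 0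

/-- The channel performed by the circuit. -/
def run (c : Circuit G I O) : OpMap (Reg I) (Reg O) where
  toFun X := c.restrict (c.unitary * c.initial X * c.unitary.conjTranspose)
  map_add' X Y := by
    have h : c.initial (X + Y) = c.initial X + c.initial Y := by
      ext s t
      simp only [initial, Matrix.of_apply, Matrix.add_apply]
      split_ifs <;> simp
    rw [h, Matrix.mul_add, Matrix.add_mul]
    ext u v
    simp only [restrict, Matrix.of_apply, Matrix.add_apply, ← Finset.sum_add_distrib]
    refine Finset.sum_congr rfl fun s _ => Finset.sum_congr rfl fun t _ => ?_
    split_ifs <;> simp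
  map_smul' z X := by
    have h : c.initial (z • X) = z • c.initial X := by
      ext s t
      simp only [initial, Matrix.of_apply, Matrix.smul_apply]
      split_ifs <;> simp
    rw [h, Matrix.mul_smul, Matrix.smul_mul]
    ext u v
    simp only [restrict, Matrix.of_apply, Matrix.smul_apply, RingHom.id_apply, smul_eq_mul,
      Finset.mul_sum]
    refine Finset.sum_congr rfl fun s _ => Finset.sum_congr rfl fun t _ => ?_
    split_ifs <;> simp

end Circuit

/-- The least number of gates of a circuit over `G` that performs `Φ` up to the error `κ` in
diamond norm (`⊤` if there is none). -/
def channelComplexity {I O : Type} [Fintype I] [DecidableEq I] [Fintype O] [DecidableEq O]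
    (G : GateSet) (κ : ℝ) (Φ : OpMap (Reg I) (Reg O)) : ℕ∞ :=
  sInf {m : ℕ∞ | ∃ c : Circuit G I O, diamondDist c.run Φ ≤ (κ : EReal) ∧ m = (c.size : ℕ∞)}

/-! ## Algorithms and computational distances -/

/-- Measurement of one qubit in the computational basis; the outcome is a classical bit. -/
def measureBit : OpMap (Reg Unit) Bool where
  toFun X := Matrix.diagonal fun b => X (fun _ => b) (fun _ => b)
  map_add' X Y := by ext i j; by_cases h : i = j <;> simp [Matrix.diagonal, h]
  map_smul' z X := by ext i j; by_cases h : i = j <;> simp [Matrix.diagonal, h]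

/-- The complexity of an algorithm, that is, of a channel with a single classical output bit:
the least number of gates of a circuit over `G` that, followed by a measurement of its output
qubit, performs the channel up to the constant error `κ` in diamond norm. -/
def algComplexity {I : Type} [Fintype I] [DecidableEq I]
    (G : GateSet) (κ : ℝ) (𝒜 : OpMap (Reg I) Bool) : ℕ∞ :=
  sInf {m : ℕ∞ | ∃ c : Circuit G I Unit,
    diamondDist (measureBit ∘ₗ c.run) 𝒜 ≤ (κ : EReal) ∧ m = (c.size : ℕ∞)}

/-- A quantum algorithm: a channel whose output is a classical bit. -/
structure Algorithm (I : Type) [Fintype I] [DecidableEq I] extends Channel (Reg I) Bool where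
  classical : ∀ X, (map X).IsDiag

/-- The probability that the algorithm outputs `1` on the input `ρ`. -/
def Algorithm.prob {I : Type} [Fintype I] [DecidableEq I] (𝒜 : Algorithm I)
    (ρ : Matrix (Reg I) (Reg I) ℂ) : ℝ :=
  (𝒜.map ρ true true).re

/-- The computationally constrained distance `D_t`. -/
def compDist {I : Type} [Fintype I] [DecidableEq I] (G : GateSet) (κ : ℝ) (t : ℕ)
    (ρ σ : Matrix (Reg I) (Reg I) ℂ) : EReal :=
  ⨆ (𝒜 : Algorithm I) (_ : algComplexity G κ 𝒜.map ≤ (t : ℕ∞)),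
    ((|𝒜.prob ρ - 𝒜.prob σ| : ℝ) : EReal)

/-- The computational diamond norm distance `‖Φ - Ψ‖_t`, a supremum over reference registers of
any number of qubits and all joint states of the input and the reference; the distinguishing
algorithm acts on the output together with the reference. -/
def compDiamondDist {a I : Type} [Fintype a] [DecidableEq a] [Fintype I] [DecidableEq I]
    (G : GateSet) (κ : ℝ) (t : ℕ) (Φ Ψ : OpMap a (Reg I)) : EReal :=
  ⨆ (r : ℕ) (ψ : State (a × Reg (Fin r))),
    compDist G κ t
      (relabel (joinReg I (Fin r)) (amplR (Reg (Fin r)) Φ ψ.mat))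
      (relabel (joinReg I (Fin r)) (amplR (Reg (Fin r)) Ψ ψ.mat))

/-! ## Encoding the secret system into qubits -/

/-- The map `X ↦ V X V†` for the isometry `V|i⟩ = |enc i⟩` that stores a `d`-dimensional system
in `q` qubits. -/
def encode {d q : ℕ} (enc : Fin d ↪ Reg (Fin q)) : OpMap (Fin d) (Reg (Fin q)) :=
  let V : Matrix (Reg (Fin q)) (Fin d) ℂ := Matrix.of fun s i => if s = enc i then 1 else 0
  LinearMap.mk
    (AddHom.mk (fun X => V * X * V.conjTranspose)
      (fun X Y => by rw [Matrix.mul_add, Matrix.add_mul]))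
    (fun z X => by simp only [Matrix.mul_smul, Matrix.smul_mul, RingHom.id_apply])

/-- The maximally entangled vector `d^{-1/2} ∑ i, |enc i⟩|enc i⟩` on two `q`-qubit registers. -/
def maxEntVec {d q : ℕ} (enc : Fin d ↪ Reg (Fin q)) : Reg (Fin q ⊕ Fin q) → ℂ :=
  fun s => ((√(d : ℝ) : ℝ) : ℂ)⁻¹ *
    ∑ i : Fin d, if s = joinReg (Fin q) (Fin q) (enc i, enc i) then 1 else 0

/-- The test of maximal entanglement: the two-outcome projective measurement `{P, 1 - P}` with
`P` the projector onto `maxEntVec`; the output bit is `1` on the outcome `P`. -/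
def maxEntTest {d q : ℕ} (enc : Fin d ↪ Reg (Fin q)) : OpMap (Reg (Fin q ⊕ Fin q)) Bool where
  toFun X :=
    let P := Matrix.vecMulVec (maxEntVec enc) (star (maxEntVec enc))
    Matrix.diagonal fun b => if b then (P * X).trace else ((1 - P) * X).trace
  map_add' X Y := by
    ext i j; cases i <;> cases j <;> simp [Matrix.mul_add]
  map_smul' z X := by
    ext i j; cases i <;> cases j <;> simp

/-! ## Conditional disclosure of quantum secrets -/

/-- A protocol for inputs `x, y ∈ {0,1}ⁿ` with a `d`-dimensional secret, messages of `ma` and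
`mb` qubits and a shared resource state on `A × B`: on input `x` Alice applies a channel to the
secret and `A`, on input `y` Bob applies a channel to `B`, and the outputs are sent to the
referee. -/
structure Protocol (n d ma mb : ℕ) (A B : Type*) [Fintype A] [DecidableEq A]
    [Fintype B] [DecidableEq B] where
  resource : State (A × B)
  alice : (Fin n → Bool) → Channel (Fin d × A) (Reg (Fin ma))
  bob : (Fin n → Bool) → Channel B (Reg (Fin mb))

namespace Protocol

variable {n d ma mb : ℕ} {A B : Type*} [Fintype A] [DecidableEq A] [Fintype B] [DecidableEq B]

/-- The map from the secret to the joint message, `ρ ↦ (alice x ⊗ bob y) (ρ ⊗ Ψ)`. -/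
def messageMap (P : Protocol n d ma mb A B) (x y : Fin n → Bool) :
    OpMap (Fin d) (Reg (Fin ma ⊕ Fin mb)) :=
  relabel (joinReg (Fin ma) (Fin mb)) ∘ₗ tensorMap (P.alice x).map (P.bob y).map ∘ₗ
    relabel (Equiv.prodAssoc (Fin d) A B).symm ∘ₗ
    (Matrix.kroneckerBilinear (R := ℂ) (α := ℂ)).flip P.resource.mat

/-- `ε`-correctness: whenever `f x y = 1`, some decoder with at most `s` gates (up to the
implementation error `κ`, its output being stored in qubits by `enc`) recovers the secret up to
`ε` in diamond norm. -/
def IsCorrect (P : Protocol n d ma mb A B) (G : GateSet) {q : ℕ} (enc : Fin d ↪ Reg (Fin q))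
    (κ : ℝ) (s : ℕ) (f : (Fin n → Bool) → (Fin n → Bool) → Bool) (ε : ℝ) : Prop :=
  ∀ x y, f x y = true → ∃ D : Channel (Reg (Fin ma ⊕ Fin mb)) (Fin d),
    channelComplexity G κ (encode enc ∘ₗ D.map) ≤ (s : ℕ∞) ∧
    diamondDist (D.map ∘ₗ P.messageMap x y) LinearMap.id ≤ (ε : EReal)

/-- The simulator after tracing out the secret: `ρ ↦ tr(ρ) σ`, where the simulator, a channel
with trivial input, is given by the state `σ` that it prepares. -/
def simulate (d : ℕ) {M : Type*} [Fintype M] [DecidableEq M] (σ : State M) : OpMap (Fin d) M :=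
  (Matrix.traceLinearMap (Fin d) ℂ ℂ).smulRight σ.mat

/-- `δ`-security against referees of complexity at most `t`: whenever `f x y = 0`, the message
can be simulated without the secret, up to `δ` in the computational diamond norm. -/
def IsSecure (P : Protocol n d ma mb A B) (G : GateSet) (κ : ℝ) (t : ℕ)
    (f : (Fin n → Bool) → (Fin n → Bool) → Bool) (δ : ℝ) : Prop :=
  ∀ x y, f x y = false → ∃ σ : State (Reg (Fin ma ⊕ Fin mb)),
    compDiamondDist G κ t (simulate d σ) (P.messageMap x y) ≤ (δ : EReal)

end Protocol

end CDQS

end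

namespace CDQS

open Matrix

/-! ## The trace norm of Hermitian matrices -/

-- The decoder of a 1-input is turned into an attack on a 0-input. Take `x, y₀, y₁` with `f x y₀ =
-- 0` and `f x y₁ = 1`, and let `D` be the decoder for `(x, y₁)`. Facing the messages of `(x, y₀)`,
-- the attacker discards Bob's message, substitutes the state `τ` that Bob would have sent on `y₁`
-- from his marginal `Ψ_B`, applies `D`, and tests maximal entanglement with the reference. Bob's
-- channel preserves the trace, so discarding its output leaves Alice with `Ψ_A`. The attack
-- therefore runs the protocol on `(x, y₁)` with the resource `Ψ_A ⊗ Ψ_B` in place of `Ψ`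
-- (`replaceSnd_comp_resourceMap`). Alice's channel is the same in both cases because `x` is.
--
-- Let `g Z` be the entanglement fidelity reached with the resource `Z` on `(x, y₁)`. It is linear
-- in `Z` with `0 ≤ g ≤ tr` on positive operators (`fidelityWith_bounds`), hence an effect on `AB`.
-- Correctness gives `g Ψ ≥ 1 - ε`. A simulated message carries no information on the secret and
-- passes the test with probability `1/d²`, so security gives `g (Ψ_A ⊗ Ψ_B) ≤ 1/d² + δ`. Security
-- applies because `τ` sits in the reference at no cost and rewiring takes no gates: the attack
-- costs a decoder and a test, with added errors (`algComplexity_decodeAndTest_le`).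
--
-- It remains to see that an effect separating `Ψ` from `Ψ_A ⊗ Ψ_B` with total error `η` forces
-- `I(A:B) ≥ -ln η - 1` (`State.neg_log_sub_one_le_mutualInfo`). Cauchy–Schwarz for `g` and `tr - g`
-- bounds the overlap `tr (√Ψ √(Ψ_A ⊗ Ψ_B))` by `√(2η)` (`re_trace_mul_le`), and the relative
-- entropy `I(A:B)` is at least `-2 ln` of this overlap (`neg_two_mul_log_le_sum_negMulLog`).

theorem exists_unitary_diagonalization {a : Type*} [Fintype a] [DecidableEq a]
    {A : Matrix a a ℂ} (hA : A.IsHermitian) :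
    ∃ U : Matrix a a ℂ, Uᴴ * U = 1 ∧ U * Uᴴ = 1 ∧
      A = U * diagonal (fun i => (hA.eigenvalues i : ℂ)) * Uᴴ := by
  refine ⟨hA.eigenvectorUnitary, ?_, ?_, ?_⟩
  · exact Unitary.coe_star_mul_self hA.eigenvectorUnitary
  · exact Unitary.coe_mul_star_self hA.eigenvectorUnitary
  · conv_lhs => rw [hA.spectral_theorem, Unitary.conjStarAlgAut_apply]
    rfl

/-- Here `Aᴴ * A = A²`; comparing the roots of characteristic polynomials identifies its spectrum,
as a multiset, with the squared eigenvalues of `A`. -/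
theorem traceNorm_eq_sum_abs {a : Type*} [Fintype a] [DecidableEq a]
    {A : Matrix a a ℂ} (hA : A.IsHermitian) :
    traceNorm A = ∑ i, |hA.eigenvalues i| := by
  have h1 : Aᴴ * A = cfc (fun x : ℝ => x ^ 2) A := by
    rw [cfc_pow_id (R := ℝ) A 2 hA.isSelfAdjoint, hA.eq, sq]
  have h2 := hA.charpoly_cfc_eq (fun x : ℝ => x ^ 2)
  rw [← h1] at h2
  have h3 := (isHermitian_conjTranspose_mul_self A).roots_charpoly_eq_eigenvalues
  rw [h2, Polynomial.roots_prod _ _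
    (Finset.prod_ne_zero_iff.2 fun i _ => Polynomial.X_sub_C_ne_zero _)] at h3
  have h4 := congrArg (fun m => (m.map fun z : ℂ => √z.re).sum) h3
  simp only [Polynomial.roots_X_sub_C, Multiset.bind_singleton, Multiset.map_map] at h4
  have h5 : ∑ i, √(hA.eigenvalues i ^ 2) = traceNorm A := by
    simp only [Function.comp_def, Complex.coe_algebraMap, Complex.ofReal_re] at h4
    exact h4
  rw [← h5]
  simp [Real.sqrt_sq_eq_abs]

theorem posSemidef_unitary_diagonal {a b : Type*} [Fintype a] [Fintype b] [DecidableEq a]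
    (U : Matrix b a ℂ) {v : a → ℝ} (hv : ∀ i, 0 ≤ v i) :
    (U * diagonal (fun i => (v i : ℂ)) * Uᴴ).PosSemidef := by
  refine PosSemidef.mul_mul_conjTranspose_same (PosSemidef.diagonal fun i => ?_) U
  simpa using hv i

theorem trace_unitary_diagonal {a : Type*} [Fintype a] [DecidableEq a]
    {U : Matrix a a ℂ} (hU : Uᴴ * U = 1) (v : a → ℂ) :
    (U * diagonal v * Uᴴ).trace = ∑ i, v i := by
  rw [trace_mul_comm, ← mul_assoc, hU, one_mul, trace_diagonal]

theorem exists_posSemidef_sub {a : Type*} [Fintype a] [DecidableEq a]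
    {A : Matrix a a ℂ} (hA : A.IsHermitian) :
    ∃ P N : Matrix a a ℂ, P.PosSemidef ∧ N.PosSemidef ∧ A = P - N ∧
      P.trace.re + N.trace.re = traceNorm A := by
  obtain ⟨U, h1, -, h3⟩ := exists_unitary_diagonalization hA
  refine ⟨U * diagonal (fun i => ((max (hA.eigenvalues i) 0 : ℝ) : ℂ)) * Uᴴ,
    U * diagonal (fun i => ((max (-hA.eigenvalues i) 0 : ℝ) : ℂ)) * Uᴴ,
    posSemidef_unitary_diagonal U fun i => le_max_right _ _,
    posSemidef_unitary_diagonal U fun i => le_max_right _ _, ?_, ?_⟩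
  · rw [← sub_mul, ← mul_sub, diagonal_sub]
    conv_lhs => rw [h3]
    congr 3
    funext i
    rw [← Complex.ofReal_sub]
    congr 1
    rcases le_total (hA.eigenvalues i) 0 with h | h
    · rw [max_eq_right h, max_eq_left (by linarith)]; ring
    · rw [max_eq_left h, max_eq_right (by linarith)]; ring
  · rw [trace_unitary_diagonal h1, trace_unitary_diagonal h1, traceNorm_eq_sum_abs hA,
      ← Complex.ofReal_sum, ← Complex.ofReal_sum, Complex.ofReal_re, Complex.ofReal_re,
      ← Finset.sum_add_distrib]
    refine Finset.sum_congr rfl fun i _ => ?_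
    rcases le_total (hA.eigenvalues i) 0 with h | h
    · rw [max_eq_right h, max_eq_left (by linarith), abs_of_nonpos h]; ring
    · rw [max_eq_left h, max_eq_right (by linarith), abs_of_nonneg h]; ring

/-- In an eigenbasis of `P - N` every eigenvalue is a difference of two nonnegative diagonal
entries. Together with `exists_posSemidef_sub`, where equality is attained, this gives a variational
formula from which the triangle inequality and contractivity follow. -/
theorem traceNorm_sub_le {a : Type*} [Fintype a] [DecidableEq a]
    {P N : Matrix a a ℂ} (hP : P.PosSemidef) (hN : N.PosSemidef) :
    traceNorm (P - N) ≤ P.trace.re + N.trace.re := by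
  have hA : (P - N).IsHermitian := hP.1.sub hN.1
  obtain ⟨U, h1, h2, h3⟩ := exists_unitary_diagonalization hA
  have key : ∀ X : Matrix a a ℂ, (Uᴴ * X * U).trace = X.trace := fun X => by
    rw [trace_mul_comm, ← mul_assoc, h2, one_mul]
  have hd : Uᴴ * P * U - Uᴴ * N * U = diagonal (fun i => (hA.eigenvalues i : ℂ)) := by
    rw [← sub_mul, ← mul_sub]
    generalize hA.eigenvalues = v at h3
    rw [h3]
    simp only [← mul_assoc, h1, one_mul]
    rw [mul_assoc, h1, mul_one]
  rw [traceNorm_eq_sum_abs hA, ← key P, ← key N, Matrix.trace, Matrix.trace, Complex.re_sum,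
    Complex.re_sum, ← Finset.sum_add_distrib]
  refine Finset.sum_le_sum fun i _ => ?_
  have e := congrArg Complex.re (congrFun (congrFun hd i) i)
  rw [Matrix.sub_apply, diagonal_apply_eq, Complex.sub_re, Complex.ofReal_re] at e
  have p1 := (Complex.le_def.1 ((hP.conjTranspose_mul_mul_same U).diag_nonneg (i := i))).1
  have p2 := (Complex.le_def.1 ((hN.conjTranspose_mul_mul_same U).diag_nonneg (i := i))).1
  rw [← e]
  simp only [diag_apply, Complex.zero_re] at p1 p2 ⊢
  rw [abs_le]
  constructor <;> linarith

theorem traceNorm_nonneg {a : Type*} [Fintype a] [DecidableEq a] (A : Matrix a a ℂ) :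
    0 ≤ traceNorm A :=
  Finset.sum_nonneg fun _ _ => Real.sqrt_nonneg _

theorem traceNorm_add_le {a : Type*} [Fintype a] [DecidableEq a]
    {A B : Matrix a a ℂ} (hA : A.IsHermitian) (hB : B.IsHermitian) :
    traceNorm (A + B) ≤ traceNorm A + traceNorm B := by
  obtain ⟨P, N, hP, hN, rfl, h1⟩ := exists_posSemidef_sub hA
  obtain ⟨P', N', hP', hN', rfl, h2⟩ := exists_posSemidef_sub hB
  have := traceNorm_sub_le (hP.add hP') (hN.add hN')
  rw [← h1, ← h2, sub_add_sub_comm]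
  simp only [trace_add, Complex.add_re] at this
  linarith

/-- On an optimal splitting `A = P - N`, the values `g P` and `g N` lie between `0` and the
respective traces. -/
theorem abs_re_le_traceNorm {a : Type*} [Fintype a] [DecidableEq a]
    {A : Matrix a a ℂ} (hA : A.IsHermitian) (g : Matrix a a ℂ →ₗ[ℂ] ℂ)
    (hg : ∀ X : Matrix a a ℂ, X.PosSemidef → 0 ≤ g X ∧ g X ≤ X.trace) :
    |(g A).re| ≤ traceNorm A := by
  obtain ⟨P, N, hP, hN, rfl, h1⟩ := exists_posSemidef_sub hA
  rw [← h1, map_sub, Complex.sub_re, abs_le]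
  have a1 := (Complex.le_def.1 (hg P hP).1).1
  have a2 := (Complex.le_def.1 (hg P hP).2).1
  have a3 := (Complex.le_def.1 (hg N hN).1).1
  have a4 := (Complex.le_def.1 (hg N hN).2).1
  simp only [Complex.zero_re] at a1 a3
  constructor <;> linarith

/-! ## Completely positive maps -/

theorem amplR_apply {a b : Type*} (r : Type*) (Φ : OpMap a b) (X : Matrix (a × r) (a × r) ℂ)
    (i j : b × r) : amplR r Φ X i j =
      Φ (X.submatrix (fun k => (k, i.2)) (fun k => (k, j.2))) i.1 j.1 := rfl

theorem amplL_apply {a b : Type*} (r : Type*) (Φ : OpMap a b) (X : Matrix (r × a) (r × a) ℂ)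
    (i j : r × b) : amplL r Φ X i j =
      Φ (X.submatrix (fun k => (i.1, k)) (fun k => (j.1, k))) i.2 j.2 := rfl

theorem amplR_kronecker {a b : Type*} (r : Type*) (Φ : OpMap a b) (X : Matrix a a ℂ)
    (Y : Matrix r r ℂ) : amplR r Φ (X ⊗ₖ Y) = Φ X ⊗ₖ Y := by
  ext ⟨i, k⟩ ⟨j, l⟩
  have : (X ⊗ₖ Y).submatrix (fun i => (i, k)) (fun j => (j, l)) = Y k l • X := by
    ext; simp [mul_comm]
  simp [amplR_apply, this, mul_comm]

theorem amplL_kronecker {a b : Type*} (r : Type*) (Φ : OpMap a b) (X : Matrix a a ℂ)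
    (Y : Matrix r r ℂ) : amplL r Φ (Y ⊗ₖ X) = Y ⊗ₖ Φ X := by
  ext ⟨k, i⟩ ⟨l, j⟩
  have : (Y ⊗ₖ X).submatrix (fun i => (k, i)) (fun j => (l, j)) = Y k l • X := by
    ext; simp
  simp [amplL_apply, this]

theorem relabel_apply {a b : Type*} (e : a ≃ b) (X : Matrix a a ℂ) :
    relabel e X = X.submatrix e.symm e.symm := rfl

/-- Complete positivity of a linear map. -/
def IsCP {a b : Type*} (Φ : OpMap a b) : Prop :=
  ∀ (r : ℕ) (X : Matrix (a × Fin r) (a × Fin r) ℂ), X.PosSemidef → (amplR (Fin r) Φ X).PosSemidef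

/-- Preservation of the trace by a linear map. -/
def IsTP {a b : Type*} [Fintype a] [Fintype b] (Φ : OpMap a b) : Prop :=
  ∀ X, (Φ X).trace = X.trace

theorem IsTP.comp {a b c : Type*} [Fintype a] [Fintype b] [Fintype c] {Φ : OpMap a b}
    {Ψ : OpMap b c} (hΨ : IsTP Ψ) (hΦ : IsTP Φ) : IsTP (Ψ ∘ₗ Φ) := fun X => by
  rw [LinearMap.comp_apply, hΨ, hΦ]

theorem IsTP.amplR {a b : Type*} [Fintype a] [Fintype b] (r : Type*) [Fintype r] {Φ : OpMap a b}
    (hΦ : IsTP Φ) : IsTP (amplR r Φ) := fun X => by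
  have : ∀ k, ∑ i, Φ (X.submatrix (fun j => (j, k)) (fun j => (j, k))) i i =
      ∑ j, X (j, k) (j, k) := fun k => hΦ _
  simp only [Matrix.trace, diag_apply, Fintype.sum_prod_type, amplR_apply]
  rw [Finset.sum_comm, Finset.sum_comm (s := (Finset.univ : Finset a))]
  exact Finset.sum_congr rfl fun k _ => this k

theorem isTP_relabel {a b : Type*} [Fintype a] [Fintype b] (e : a ≃ b) : IsTP (relabel e) :=
  fun X => by
    simp only [relabel_apply, Matrix.trace, diag_apply, submatrix_apply]
    exact Equiv.sum_comp e.symm fun i => X i i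

theorem IsCP.amplR_posSemidef {a b r : Type*} [Fintype r] {Φ : OpMap a b} (hΦ : IsCP Φ)
    {X : Matrix (a × r) (a × r) ℂ} (hX : X.PosSemidef) : (amplR r Φ X).PosSemidef := by
  have e := Fintype.equivFin r
  have h := hΦ _ _ (hX.submatrix (Prod.map id e.symm))
  convert h.submatrix (Prod.map id e) using 1
  ext ⟨i, k⟩ ⟨j, l⟩
  simp only [amplR_apply, submatrix_apply, Prod.map_snd, Prod.map_fst, id, submatrix_submatrix]
  refine congrArg (fun M => Φ M i j) ?_
  ext
  simp

theorem IsCP.posSemidef {a b : Type*} {Φ : OpMap a b} (hΦ : IsCP Φ)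
    {X : Matrix a a ℂ} (hX : X.PosSemidef) : (Φ X).PosSemidef :=
  (hΦ 1 _ (hX.submatrix Prod.fst)).submatrix fun i => (i, 0)

theorem IsCP.comp {a b c : Type*} {Φ : OpMap a b} {Ψ : OpMap b c} (hΨ : IsCP Ψ) (hΦ : IsCP Φ) :
    IsCP (Ψ ∘ₗ Φ) := fun r X hX => hΨ r _ (hΦ r X hX)

theorem IsCP.sum {a b ι : Type*} (s : Finset ι) {Φ : ι → OpMap a b} (hΦ : ∀ i, IsCP (Φ i)) :
    IsCP (∑ i ∈ s, Φ i) := fun r X hX => by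
  have : amplR (Fin r) (∑ i ∈ s, Φ i) X = ∑ i ∈ s, amplR (Fin r) (Φ i) X := by
    ext i j
    simp [amplR_apply, Matrix.sum_apply, LinearMap.sum_apply]
  rw [this]
  exact posSemidef_sum _ fun i _ => hΦ i r X hX

theorem IsCP.amplR {a b : Type*} (r : Type*) [Fintype r] {Φ : OpMap a b} (hΦ : IsCP Φ) :
    IsCP (amplR r Φ) := fun k _ hX =>
  (hΦ.amplR_posSemidef (hX.submatrix (Equiv.prodAssoc a r (Fin k)).symm)).submatrix
    (Equiv.prodAssoc b r (Fin k))

/-- The map `X ↦ (X_{f i, f j})`. -/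
def submatrixMap {a b : Type*} (f : b → a) : OpMap a b where
  toFun X := X.submatrix f f
  map_add' _ _ := rfl
  map_smul' _ _ := rfl

theorem isCP_submatrixMap {a b : Type*} (f : b → a) : IsCP (submatrixMap f) := fun r _ hX =>
  hX.submatrix fun i : b × Fin r => (f i.1, i.2)

theorem isCP_relabel {a b : Type*} (e : a ≃ b) : IsCP (relabel e) := fun r _ hX =>
  hX.submatrix fun i : b × Fin r => (e.symm i.1, i.2)

theorem IsCP.amplL {a b : Type*} (r : Type*) [Fintype r] {Φ : OpMap a b} (hΦ : IsCP Φ) :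
    IsCP (amplL r Φ) :=
  (isCP_relabel (Equiv.prodComm b r)).comp ((hΦ.amplR r).comp (isCP_relabel (Equiv.prodComm r a)))

/-- Conjugation `X ↦ K X K†`. -/
def conjMap {a b : Type*} [Fintype a] (K : Matrix b a ℂ) : OpMap a b where
  toFun X := K * X * Kᴴ
  map_add' X Y := by rw [Matrix.mul_add, Matrix.add_mul]
  map_smul' z X := by simp

theorem isCP_conjMap {a b : Type*} [Fintype a] [Finite b] (K : Matrix b a ℂ) : IsCP (conjMap K) :=
  fun r X hX => by
    convert hX.mul_mul_conjTranspose_same (K ⊗ₖ (1 : Matrix (Fin r) (Fin r) ℂ)) using 1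
    ext ⟨i, k⟩ ⟨j, l⟩
    simp only [amplR_apply, conjMap, mul_apply, Fintype.sum_prod_type, one_apply,
      LinearMap.coe_mk, AddHom.coe_mk, submatrix_apply, conjTranspose_apply, kroneckerMap_apply,
      mul_ite, mul_one, mul_zero, ite_mul, zero_mul, Finset.sum_ite_eq, Finset.mem_univ, if_true,
      apply_ite star, star_zero]

/-- A channel maps an optimal splitting of `X` into positive parts to a splitting of `Φ X` with the
same traces. -/
theorem traceNorm_map_le {a b : Type*} [Fintype a] [DecidableEq a] [Fintype b] [DecidableEq b]
    {Φ : OpMap a b} (hΦ : IsCP Φ) (hT : IsTP Φ) {X : Matrix a a ℂ} (hX : X.IsHermitian) :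
    traceNorm (Φ X) ≤ traceNorm X := by
  obtain ⟨P, N, hP, hN, rfl, h⟩ := exists_posSemidef_sub hX
  rw [← h, map_sub, ← hT P, ← hT N]
  exact traceNorm_sub_le (hΦ.posSemidef hP) (hΦ.posSemidef hN)

theorem Channel.isCP {a b : Type*} [Fintype a] [DecidableEq a] [Fintype b] [DecidableEq b]
    (Φ : Channel a b) : IsCP Φ.map := Φ.completelyPositive

theorem Channel.isTP {a b : Type*} [Fintype a] [DecidableEq a] [Fintype b] [DecidableEq b]
    (Φ : Channel a b) : IsTP Φ.map := Φ.tracePreserving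

/-! ## The diamond norm distance -/

/-- The supremum in `diamondDist` runs over references `Fin r` only; relabelling the basis makes
every finite reference available, in particular a product with idle wires. -/
theorem traceNorm_le_diamondDist {a b r : Type*} [Fintype a] [DecidableEq a] [Fintype b]
    [DecidableEq b] [Fintype r] [DecidableEq r] {Φ Ψ : OpMap a b} (hΦ : IsCP Φ) (hΨ : IsCP Ψ)
    (ρ : State (a × r)) :
    ((traceNorm (amplR r Φ ρ.mat - amplR r Ψ ρ.mat) : ℝ) : EReal) ≤ diamondDist Φ Ψ := by
  have e := Fintype.equivFin r
  let ρ' : State (a × Fin (Fintype.card r)) :=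
    { mat := relabel (Equiv.prodCongr (Equiv.refl a) e) ρ.mat
      posSemidef := (isCP_relabel _).posSemidef ρ.posSemidef
      trace_one := by rw [isTP_relabel, ρ.trace_one] }
  refine le_trans ?_ (le_iSup₂ (f := fun (r : ℕ) (ψ : State (a × Fin r)) =>
    ((traceNorm (amplR (Fin r) Φ ψ.mat - amplR (Fin r) Ψ ψ.mat) : ℝ) : EReal)) _ ρ')
  rw [EReal.coe_le_coe_iff]
  have h : ∀ Θ : OpMap a b, amplR r Θ ρ.mat = relabel (Equiv.prodCongr (Equiv.refl b) e.symm)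
      (amplR (Fin (Fintype.card r)) Θ ρ'.mat) := fun Θ => by
    ext ⟨i, k⟩ ⟨j, l⟩
    simp only [relabel_apply, submatrix_apply, amplR_apply, ρ', submatrix_submatrix]
    refine congrArg (fun M => Θ M i j) ?_
    ext
    simp
  rw [h, h, ← map_sub]
  exact traceNorm_map_le (isCP_relabel _) (isTP_relabel _)
    ((hΦ.amplR_posSemidef ρ'.posSemidef).1.sub (hΨ.amplR_posSemidef ρ'.posSemidef).1)

/-- Errors add up when maps are composed: the first stage may carry an idle register `J`, and is
preceded by a preparation `P`. -/
theorem diamondDist_comp_le {a a' b c J : Type*} [Fintype a] [DecidableEq a] [Fintype a']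
    [DecidableEq a'] [Fintype b] [DecidableEq b] [Fintype c] [DecidableEq c] [Fintype J]
    [DecidableEq J] {P : OpMap a' (a × J)} (hP : IsCP P) (hP' : IsTP P)
    {Φ₁ Ψ₁ : OpMap a b} (hΦ₁ : IsCP Φ₁) (hΦ₁' : IsTP Φ₁) (hΨ₁ : IsCP Ψ₁)
    {Φ₂ Ψ₂ : OpMap (b × J) c} (hΦ₂ : IsCP Φ₂) (hΨ₂ : IsCP Ψ₂) (hΨ₂' : IsTP Ψ₂)
    {κ₁ κ₂ : ℝ} (h₁ : diamondDist Φ₁ Ψ₁ ≤ κ₁) (h₂ : diamondDist Φ₂ Ψ₂ ≤ κ₂) :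
    diamondDist (Φ₂ ∘ₗ amplR J Φ₁ ∘ₗ P) (Ψ₂ ∘ₗ amplR J Ψ₁ ∘ₗ P) ≤ ((κ₁ + κ₂ : ℝ) : EReal) := by
  refine iSup₂_le fun r ψ => ?_
  rw [EReal.coe_le_coe_iff]
  let σ : State ((a × J) × Fin r) :=
    { mat := amplR (Fin r) P ψ.mat
      posSemidef := hP.amplR_posSemidef ψ.posSemidef
      trace_one := by rw [hP'.amplR (Fin r), ψ.trace_one] }
  -- For the first stage the idle register `J` counts as part of the reference.
  let σ₁ : State (a × (J × Fin r)) :=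
    { mat := relabel (Equiv.prodAssoc _ _ _) σ.mat
      posSemidef := (isCP_relabel _).posSemidef σ.posSemidef
      trace_one := by rw [isTP_relabel, σ.trace_one] }
  let σ₂ : State ((b × J) × Fin r) :=
    { mat := amplR (Fin r) (amplR J Φ₁) σ.mat
      posSemidef := (hΦ₁.amplR J).amplR_posSemidef σ.posSemidef
      trace_one := by rw [(hΦ₁'.amplR J).amplR (Fin r), σ.trace_one] }
  have e₁ := EReal.coe_le_coe_iff.1 ((traceNorm_le_diamondDist hΦ₁ hΨ₁ σ₁).trans h₁)
  have e₂ := EReal.coe_le_coe_iff.1 ((traceNorm_le_diamondDist hΦ₂ hΨ₂ σ₂).trans h₂)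
  have hs : ∀ Θ : OpMap a b, amplR (Fin r) (amplR J Θ) σ.mat =
      relabel (Equiv.prodAssoc _ _ _).symm (amplR (J × Fin r) Θ σ₁.mat) := fun Θ => rfl
  have hH : (amplR (J × Fin r) Φ₁ σ₁.mat - amplR (J × Fin r) Ψ₁ σ₁.mat).IsHermitian :=
    (hΦ₁.amplR_posSemidef σ₁.posSemidef).1.sub (hΨ₁.amplR_posSemidef σ₁.posSemidef).1
  -- Hybrid argument through `Ψ₂` after `Φ₁`: exchanging the second stage costs `κ₂` by `e₂`, and
  -- exchanging the first costs `κ₁`, since `Ψ₂` contracts the trace norm.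
  have e₃ : traceNorm (amplR (Fin r) Ψ₂ (amplR (Fin r) (amplR J Φ₁) σ.mat) -
      amplR (Fin r) Ψ₂ (amplR (Fin r) (amplR J Ψ₁) σ.mat)) ≤ κ₁ := by
    rw [← map_sub, hs, hs, ← map_sub]
    refine (traceNorm_map_le (hΨ₂.amplR _) (hΨ₂'.amplR _) ?_).trans
      ((traceNorm_map_le (isCP_relabel _) (isTP_relabel _) hH).trans e₁)
    exact hH.submatrix _
  have q₁ := (hΦ₂.amplR (Fin r)).posSemidef σ₂.posSemidef
  have q₂ := (hΨ₂.amplR (Fin r)).posSemidef σ₂.posSemidef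
  have q₃ := (hΨ₂.amplR (Fin r)).posSemidef ((hΨ₁.amplR J).amplR_posSemidef (r := Fin r)
    σ.posSemidef)
  have e₄ := traceNorm_add_le (q₁.1.sub q₂.1) (q₂.1.sub q₃.1)
  rw [sub_add_sub_cancel] at e₄
  refine e₄.trans ?_
  linarith [e₂, e₃]

/-! ## Operators on some wires of a register -/

/-- The trace pairing is nondegenerate. Channels can thus be compared through their action on
observables. -/
theorem ext_of_trace_mul {a : Type*} [Fintype a] [DecidableEq a] {X Y : Matrix a a ℂ}
    (h : ∀ E : Matrix a a ℂ, (E * X).trace = (E * Y).trace) : X = Y := by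
  ext i j
  simpa [trace_single_mul] using h (single j i 1)

theorem linearMap_ext_kronecker {a b : Type*} [Fintype a] [DecidableEq a] [Fintype b]
    [DecidableEq b] {M : Type*} [AddCommGroup M] [Module ℂ M]
    {f g : Matrix (a × b) (a × b) ℂ →ₗ[ℂ] M}
    (h : ∀ (X : Matrix a a ℂ) (Y : Matrix b b ℂ), f (X ⊗ₖ Y) = g (X ⊗ₖ Y)) : f = g := by
  refine Matrix.ext_linearMap ℂ fun ⟨i, k⟩ ⟨j, l⟩ => ?_
  ext
  have := h (single i j 1) (single k l 1)
  rw [single_kronecker_single, one_mul] at this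
  simpa using this

/-- The operator `U` on the wires `p`, and the identity on all other wires. -/
noncomputable def place {V W : Type} (p : V ↪ W) (U : Matrix (Reg V) (Reg V) ℂ) :
    Matrix (Reg W) (Reg W) ℂ :=
  open Classical in
  Matrix.of fun s t => if ∀ w, w ∉ Set.range p → s w = t w then U (s ∘ p) (t ∘ p) else 0

open Classical in
theorem place_apply {V W : Type} (p : V ↪ W) (U : Matrix (Reg V) (Reg V) ℂ) (s t : Reg W) :
    place p U s t = if ∀ w, w ∉ Set.range p → s w = t w then U (s ∘ p) (t ∘ p) else 0 := rfl

/-- The wires of `W` split into those of `V` and those of `N`. -/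
def splitReg {V N W : Type} (e : V ⊕ N ≃ W) : Reg W ≃ Reg V × Reg N where
  toFun s := (fun v => s (e (Sum.inl v)), fun n => s (e (Sum.inr n)))
  invFun x w := Sum.elim x.1 x.2 (e.symm w)
  left_inv s := by
    funext w
    obtain ⟨x | x, rfl⟩ := e.surjective w <;> simp
  right_inv x := by simp

/-- Every choice of wires becomes the left summand of a disjoint union, so identities for `place`
reduce to identities for `U ⊗ 1`. -/
theorem exists_splitting {V W : Type} [Fintype W] [DecidableEq W] (p : V ↪ W) :
    ∃ (N : Type) (_ : Fintype N) (_ : DecidableEq N) (e : V ⊕ N ≃ W),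
      Function.Embedding.inl.trans e.toEmbedding = p := by
  classical
  refine ⟨{w // w ∉ Set.range p}, inferInstance, inferInstance,
    ((Equiv.ofInjective p p.injective).sumCongr (Equiv.refl _)).trans
      (Equiv.Set.sumCompl (Set.range p)), ?_⟩
  ext v
  exact Equiv.Set.sumCompl_apply_inl _ _

theorem agree_off_range_iff {V N W : Type} (e : V ⊕ N ≃ W) (s t : Reg W) :
    (∀ w, w ∉ Set.range (Function.Embedding.inl.trans e.toEmbedding) → s w = t w) ↔
      (splitReg e s).2 = (splitReg e t).2 := by
  rw [funext_iff, ← e.forall_congr_right]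
  simp [splitReg]

theorem place_eq_kronecker {V N W : Type} [Fintype N] [DecidableEq N] (e : V ⊕ N ≃ W)
    (U : Matrix (Reg V) (Reg V) ℂ) :
    place (Function.Embedding.inl.trans e.toEmbedding) U =
      (U ⊗ₖ (1 : Matrix (Reg N) (Reg N) ℂ)).submatrix (splitReg e) (splitReg e) := by
  ext s t
  have h := agree_off_range_iff e s t
  simp only [place_apply, h, submatrix_apply, kroneckerMap_apply, splitReg, Equiv.coe_fn_mk,
    one_apply, mul_ite, mul_one, mul_zero]
  rfl

section

variable {V V' W : Type} [Fintype V] [DecidableEq V] [Fintype V'] [DecidableEq V']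
  [Fintype W] [DecidableEq W]

theorem place_mul (p : V ↪ W) (A B : Matrix (Reg V) (Reg V) ℂ) :
    place p (A * B) = place p A * place p B := by
  obtain ⟨N, _, _, e, rfl⟩ := exists_splitting p
  rw [place_eq_kronecker, place_eq_kronecker, place_eq_kronecker, submatrix_mul_equiv,
    ← mul_kronecker_mul, one_mul]

theorem place_one {V W : Type} [DecidableEq (Reg V)] [Fintype W] [DecidableEq W]
    (p : V ↪ W) : place p (1 : Matrix (Reg V) (Reg V) ℂ) = 1 := by
  obtain ⟨N, _, _, e, rfl⟩ := exists_splitting p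
  rw [place_eq_kronecker, one_kronecker_one, submatrix_one_equiv]

theorem place_conjTranspose {V W : Type} [Fintype W] [DecidableEq W]
    (p : V ↪ W) (A : Matrix (Reg V) (Reg V) ℂ) :
    place p Aᴴ = (place p A)ᴴ := by
  obtain ⟨N, _, _, e, rfl⟩ := exists_splitting p
  rw [place_eq_kronecker, place_eq_kronecker, conjTranspose_submatrix, conjTranspose_kronecker,
    conjTranspose_one]

theorem place_place {V V' W : Type} (p : V' ↪ W) (q : V ↪ V') (A : Matrix (Reg V) (Reg V) ℂ) :
    place p (place q A) = place (q.trans p) A := by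
  classical
  ext s t
  simp only [place_apply, ← ite_and]
  refine if_congr ?_ rfl rfl
  constructor
  · rintro ⟨h1, h2⟩ w hw
    by_cases hp : w ∈ Set.range p
    · obtain ⟨v, rfl⟩ := hp
      exact h2 v fun ⟨x, hx⟩ => hw ⟨x, by simp [hx]⟩
    · exact h1 w hp
  · refine fun h => ⟨fun w hw => h w fun ⟨x, hx⟩ => hw ⟨q x, hx⟩, fun v hv => h (p v) ?_⟩
    rintro ⟨x, hx⟩
    exact hv ⟨x, p.injective hx⟩

theorem place_equiv_submatrix {V W : Type} {α : Type*} (e : V ≃ W) (A : Matrix (Reg V) (Reg V) ℂ)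
    (f : α → Reg W) :
    (place e.toEmbedding A).submatrix f f = A.submatrix (fun i => f i ∘ e) fun i => f i ∘ e := by
  ext i j
  simp [place_apply]

theorem relabel_joinReg_kronecker (A : Matrix (Reg V) (Reg V) ℂ) (B : Matrix (Reg V') (Reg V') ℂ) :
    relabel (joinReg V V') (A ⊗ₖ B) =
      place Function.Embedding.inl A * place Function.Embedding.inr B := by
  have h1 : place (Function.Embedding.inl : V ↪ V ⊕ V') A =
      relabel (joinReg V V') (A ⊗ₖ (1 : Matrix (Reg V') (Reg V') ℂ)) :=
    place_eq_kronecker (Equiv.refl (V ⊕ V')) A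
  have h2 : place (Function.Embedding.inr : V' ↪ V ⊕ V') B =
      relabel (joinReg V V') ((1 : Matrix (Reg V) (Reg V) ℂ) ⊗ₖ B) := by
    have := place_eq_kronecker (Equiv.sumComm V' V) B
    refine Eq.trans ?_ (this.trans ?_)
    · congr 1
    · ext s t
      exact mul_comm _ _
  rw [h1, h2, relabel_apply, relabel_apply, relabel_apply, submatrix_mul_equiv,
    ← mul_kronecker_mul, one_mul, mul_one]

theorem place_relabel_kronecker (r : V ⊕ V' ↪ W) (A : Matrix (Reg V) (Reg V) ℂ)
    (B : Matrix (Reg V') (Reg V') ℂ) :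
    place r (relabel (joinReg V V') (A ⊗ₖ B)) =
      place (Function.Embedding.inl.trans r) A * place (Function.Embedding.inr.trans r) B := by
  rw [relabel_joinReg_kronecker, place_mul, place_place, place_place]

/-- Operators on disjoint wires commute: both products are the placement of `A ⊗ B`. -/
theorem place_commute (r : V ⊕ V' ↪ W) (A : Matrix (Reg V) (Reg V) ℂ)
    (B : Matrix (Reg V') (Reg V') ℂ) :
    place (Function.Embedding.inr.trans r) B * place (Function.Embedding.inl.trans r) A =
      place (Function.Embedding.inl.trans r) A * place (Function.Embedding.inr.trans r) B := by
  have h1 := place_relabel_kronecker r A (1 : Matrix (Reg V') (Reg V') ℂ)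
  have h2 := place_relabel_kronecker r (1 : Matrix (Reg V) (Reg V) ℂ) B
  rw [place_one, mul_one] at h1
  rw [place_one, one_mul] at h2
  rw [← h1, ← h2, ← place_mul, ← place_mul, relabel_apply, relabel_apply, submatrix_mul_equiv,
    submatrix_mul_equiv, ← mul_kronecker_mul, ← mul_kronecker_mul, one_mul, mul_one, mul_one,
    one_mul]

end

/-- The partial trace over the wires `N`. -/
def traceOut {V N W : Type} [Fintype N] [DecidableEq N] (e : V ⊕ N ≃ W) :
    OpMap (Reg W) (Reg V) :=
  ∑ m : Reg N, submatrixMap fun u => (splitReg e).symm (u, m)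

theorem traceOut_apply {V N W : Type} [Fintype N] [DecidableEq N] (e : V ⊕ N ≃ W)
    (X : Matrix (Reg W) (Reg W) ℂ) (u v : Reg V) :
    traceOut e X u v = ∑ m : Reg N, X ((splitReg e).symm (u, m)) ((splitReg e).symm (v, m)) := by
  simp only [traceOut, LinearMap.sum_apply, Matrix.sum_apply]
  rfl

theorem isCP_traceOut {V N W : Type} [Fintype N] [DecidableEq N] (e : V ⊕ N ≃ W) :
    IsCP (traceOut e) := IsCP.sum _ fun _ => isCP_submatrixMap _

/-- The partial trace is adjoint to `E ↦ E ⊗ 1`. -/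
theorem trace_mul_traceOut {V N W : Type} [Fintype V] [DecidableEq V] [Fintype N] [DecidableEq N]
    [Fintype W] [DecidableEq W] (e : V ⊕ N ≃ W) (E : Matrix (Reg V) (Reg V) ℂ)
    (X : Matrix (Reg W) (Reg W) ℂ) :
    (E * traceOut e X).trace =
      (place (Function.Embedding.inl.trans e.toEmbedding) E * X).trace := by
  rw [place_eq_kronecker]
  simp only [Matrix.trace, diag_apply, mul_apply, traceOut_apply]
  rw [← (splitReg e).symm.sum_comp]
  simp_rw [← (splitReg e).symm.sum_comp (fun j => _ * X j _)]
  simp only [Fintype.sum_prod_type, submatrix_apply, Equiv.apply_symm_apply, kroneckerMap_apply,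
    one_apply, mul_ite, mul_one, mul_zero, ite_mul, zero_mul, Finset.sum_ite_eq, Finset.mem_univ,
    if_true, Finset.mul_sum]
  exact Finset.sum_congr rfl fun i _ => Finset.sum_comm

theorem isTP_traceOut {V N W : Type} [Fintype V] [DecidableEq V] [Fintype N] [DecidableEq N]
    [Fintype W] [DecidableEq W] (e : V ⊕ N ≃ W) : IsTP (traceOut e) := fun X => by
  have := trace_mul_traceOut e 1 X
  rwa [place_one, one_mul, one_mul] at this

/-! ## Ancillas -/

/-- Ancillas in the state `0` are added to a basis state. -/
def zeroExt {I N : Type} (i : Reg I) : Reg (I ⊕ N) := Sum.elim i fun _ => false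

/-- The isometry that adjoins ancillas in the state `0`. -/
def ancMat (I N : Type) [Fintype I] [DecidableEq I] [Fintype N] [DecidableEq N] :
    Matrix (Reg (I ⊕ N)) (Reg I) ℂ :=
  Matrix.of fun s i => if s = zeroExt i then 1 else 0

section

variable {I N I' : Type} [Fintype I] [DecidableEq I] [Fintype N] [DecidableEq N]
  [Fintype I'] [DecidableEq I']

theorem eq_zeroExt_iff {I N : Type} (s : Reg (I ⊕ N)) (i : Reg I) :
    s = zeroExt i ↔ (∀ k, s (Sum.inr k) = false) ∧ i = fun k => s (Sum.inl k) := by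
  constructor
  · rintro rfl
    exact ⟨fun _ => rfl, rfl⟩
  · rintro ⟨h, rfl⟩
    funext w
    rcases w with w | w
    · rfl
    · exact h w

theorem mul_ancMat {α : Type*} (Y : Matrix α (Reg (I ⊕ N)) ℂ) :
    Y * ancMat I N = Y.submatrix id zeroExt := by
  ext i j
  simp [mul_apply, ancMat]

theorem conjTranspose_ancMat_mul_mul (Y : Matrix (Reg (I ⊕ N)) (Reg (I ⊕ N)) ℂ) :
    (ancMat I N)ᴴ * Y * ancMat I N = Y.submatrix zeroExt zeroExt := by
  rw [mul_ancMat]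
  ext i j
  simp [mul_apply, ancMat]

theorem place_inl_mul_ancMat (A : Matrix (Reg I) (Reg I) ℂ) :
    place (Function.Embedding.inl : I ↪ I ⊕ N) A * ancMat I N = ancMat I N * A := by
  rw [mul_ancMat]
  ext s j
  simp only [submatrix_apply, id, place_apply, mul_apply, ancMat, of_apply, ite_mul, one_mul,
    zero_mul, eq_zeroExt_iff, ite_and]
  by_cases h : ∀ k, s (Sum.inr k) = false
  · simp only [h, implies_true, if_true, Finset.sum_ite_eq', Finset.mem_univ]
    rw [if_pos]
    · rfl
    · rintro (w | w) hw
      · exact (hw ⟨w, rfl⟩).elim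
      · exact h w
  · simp only [h, if_false, Finset.sum_const_zero]
    rw [if_neg]
    exact fun h' => h fun k => h' (Sum.inr k) (by simp)

/-- Taking entries at `zeroExt` is compression by the ancilla isometry, and operators off the
ancillas pass through that isometry. -/
theorem submatrix_place_inl_mul_mul (A B : Matrix (Reg I) (Reg I) ℂ)
    (Y : Matrix (Reg (I ⊕ N)) (Reg (I ⊕ N)) ℂ) :
    (place Function.Embedding.inl A * Y * place Function.Embedding.inl B).submatrix zeroExt zeroExt
      = A * Y.submatrix zeroExt zeroExt * B := by
  have h := congrArg conjTranspose (place_inl_mul_ancMat (N := N) Aᴴ)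
  rw [conjTranspose_mul, conjTranspose_mul, ← place_conjTranspose, conjTranspose_conjTranspose] at h
  rw [← conjTranspose_ancMat_mul_mul, ← conjTranspose_ancMat_mul_mul]
  simp only [Matrix.mul_assoc]
  rw [place_inl_mul_ancMat]
  simp only [← Matrix.mul_assoc]
  rw [h]

/-- An embedding of wires, extended by ancillas. -/
def withAnc {I I' : Type} (N : Type) (p : I ↪ I') : I ⊕ N ↪ I' ⊕ N :=
  p.sumMap (Function.Embedding.refl N)

theorem submatrix_place_withAnc {I I' N : Type} (p : I ↪ I')
    (A : Matrix (Reg (I ⊕ N)) (Reg (I ⊕ N)) ℂ) :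
    (place (withAnc N p) A).submatrix zeroExt zeroExt = place p (A.submatrix zeroExt zeroExt) := by
  classical
  ext s t
  simp only [submatrix_apply, place_apply]
  have hz : ∀ s : Reg I', zeroExt s ∘ withAnc N p = zeroExt (s ∘ p) := fun s => by
    funext w
    rcases w with w | w <;> rfl
  rw [hz, hz]
  refine if_congr ?_ rfl rfl
  constructor
  · intro h w hw
    refine h (Sum.inl w) ?_
    rintro ⟨x | x, hx⟩
    · exact hw ⟨x, Sum.inl_injective hx⟩
    · simp [withAnc] at hx
  · rintro h (w | w) hw
    · exact h w fun ⟨x, hx⟩ => hw ⟨Sum.inl x, by simp [withAnc, hx]⟩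
    · rfl

end

/-! ## Circuits in the Heisenberg picture -/

/-- The unitary performed by a list of gates. -/
noncomputable def gateProd {G : GateSet} {W : Type} [Fintype W] [DecidableEq W]
    (l : List ((g : G.Gate) × (Fin (G.arity g) ↪ W))) : Matrix (Reg W) (Reg W) ℂ :=
  l.foldl (fun U g => placeGate (G.mat g.1) g.2 * U) 1

/-- The gates of a list, moved to other wires. -/
def moveGates {G : GateSet} {V W : Type} (p : V ↪ W)
    (l : List ((g : G.Gate) × (Fin (G.arity g) ↪ V))) :
    List ((g : G.Gate) × (Fin (G.arity g) ↪ W)) :=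
  l.map fun g => ⟨g.1, g.2.trans p⟩

section

variable {G : GateSet} {V W : Type} [Fintype V] [DecidableEq V] [Fintype W] [DecidableEq W]

theorem foldl_gates_eq (l : List ((g : G.Gate) × (Fin (G.arity g) ↪ W)))
    (A : Matrix (Reg W) (Reg W) ℂ) :
    l.foldl (fun U g => placeGate (G.mat g.1) g.2 * U) A = gateProd l * A := by
  induction l generalizing A with
  | nil => simp [gateProd]
  | cons g l ih =>
    rw [gateProd, List.foldl_cons, List.foldl_cons, ih, ih, mul_one, Matrix.mul_assoc]

theorem gateProd_cons (g : (g : G.Gate) × (Fin (G.arity g) ↪ W))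
    (l : List ((g : G.Gate) × (Fin (G.arity g) ↪ W))) :
    gateProd (g :: l) = gateProd l * place g.2 (G.mat g.1) := by
  conv_lhs => rw [gateProd, List.foldl_cons, foldl_gates_eq, mul_one]
  rfl

theorem gateProd_append (l l' : List ((g : G.Gate) × (Fin (G.arity g) ↪ W))) :
    gateProd (l ++ l') = gateProd l' * gateProd l := by
  rw [gateProd, List.foldl_append, foldl_gates_eq]
  rfl

theorem gateProd_moveGates (p : V ↪ W) (l : List ((g : G.Gate) × (Fin (G.arity g) ↪ V))) :
    gateProd (moveGates p l) = place p (gateProd l) := by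
  induction l with
  | nil => exact (place_one p).symm
  | cons g l ih =>
    rw [moveGates, List.map_cons, gateProd_cons, gateProd_cons, place_mul, place_place, ← ih]
    rfl

theorem gateProd_unitary (l : List ((g : G.Gate) × (Fin (G.arity g) ↪ W))) :
    (gateProd l)ᴴ * gateProd l = 1 := by
  induction l with
  | nil => simp [gateProd]
  | cons g l ih =>
    have hg : (G.mat g.1)ᴴ * G.mat g.1 = 1 := (mem_unitaryGroup_iff'.1 (G.unitary g.1))
    rw [gateProd_cons, conjTranspose_mul, Matrix.mul_assoc, ← Matrix.mul_assoc (gateProd l)ᴴ, ih,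
      Matrix.one_mul, ← place_conjTranspose, ← place_mul, hg, place_one]

end

namespace Circuit

theorem unitary_eq {G : GateSet} {I O : Type} [Fintype I] [DecidableEq I] (c : Circuit G I O) :
    c.unitary = gateProd c.gates := rfl

theorem unitary_conjTranspose_mul {G : GateSet} {I O : Type} [Fintype I] [DecidableEq I]
    (c : Circuit G I O) : c.unitaryᴴ * c.unitary = 1 :=
  gateProd_unitary c.gates

theorem initial_eq {G : GateSet} {I O : Type} [Fintype I] [DecidableEq I]
    (c : Circuit G I O) (X : Matrix (Reg I) (Reg I) ℂ) :
    c.initial X = conjMap (ancMat I (Fin c.anc)) X := by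
  ext s t
  simp only [initial, of_apply, conjMap, LinearMap.coe_mk, AddHom.coe_mk, mul_apply, ancMat,
    conjTranspose_apply, eq_zeroExt_iff, ite_and, ite_mul, one_mul, zero_mul]
  by_cases hs : ∀ k, s (Sum.inr k) = false
  · by_cases ht : ∀ k, t (Sum.inr k) = false
    · simp [hs, ht]
    · have : ¬ ∀ k, s (Sum.inr k) = false ∧ t (Sum.inr k) = false := fun h => ht fun k => (h k).2
      simp [this, ht]
  · have : ¬ ∀ k, s (Sum.inr k) = false ∧ t (Sum.inr k) = false := fun h => hs fun k => (h k).1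
    simp [this, hs]

variable {G : GateSet} {I O K : Type} [Fintype I] [DecidableEq I] [Fintype O] [DecidableEq O]
  [Fintype K] [DecidableEq K]

theorem restrict_eq (c : Circuit G I O) {N : Type} [Fintype N] [DecidableEq N]
    (e : O ⊕ N ≃ I ⊕ Fin c.anc) (he : Function.Embedding.inl.trans e.toEmbedding = c.out)
    (Y : Matrix (Reg (I ⊕ Fin c.anc)) (Reg (I ⊕ Fin c.anc)) ℂ) :
    c.restrict Y = traceOut e Y := by
  ext u v
  have h : ∀ x y : Reg (I ⊕ Fin c.anc),
      (x ∘ c.out = u ∧ y ∘ c.out = v ∧ ∀ w, w ∉ Set.range c.out → x w = y w) ↔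
      ((splitReg e x).1 = u ∧ (splitReg e y).1 = v ∧ (splitReg e x).2 = (splitReg e y).2) := by
    intro x y
    rw [← he, agree_off_range_iff]
    rfl
  rw [traceOut_apply]
  simp only [restrict, of_apply, h]
  rw [← (splitReg e).symm.sum_comp]
  simp_rw [← (splitReg e).symm.sum_comp (fun y => ite _ (Y _ y) _), Equiv.apply_symm_apply,
    Fintype.sum_prod_type, ite_and]
  rw [Finset.sum_eq_single u]
  · refine Finset.sum_congr rfl fun m _ => ?_
    rw [Finset.sum_eq_single v]
    · simp
    · intro v' _ hv'
      simp [hv']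
    · simp
  · intro u' _ hu'
    simp [hu']
  · simp

theorem run_eq (c : Circuit G I O) {N : Type} [Fintype N] [DecidableEq N]
    (e : O ⊕ N ≃ I ⊕ Fin c.anc) (he : Function.Embedding.inl.trans e.toEmbedding = c.out) :
    c.run = traceOut e ∘ₗ conjMap c.unitary ∘ₗ conjMap (ancMat I (Fin c.anc)) := by
  refine LinearMap.ext fun X => ?_
  rw [LinearMap.comp_apply, LinearMap.comp_apply, ← initial_eq, ← restrict_eq c e he]
  rfl

theorem isCP_run (c : Circuit G I O) : IsCP c.run := by
  obtain ⟨N, _, _, e, he⟩ := exists_splitting c.out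
  rw [c.run_eq e he]
  exact (isCP_traceOut e).comp ((isCP_conjMap _).comp (isCP_conjMap _))

/-- The action of the circuit on observables. -/
noncomputable def dual (c : Circuit G I O) (E : Matrix (Reg O) (Reg O) ℂ) :
    Matrix (Reg I) (Reg I) ℂ :=
  (c.unitaryᴴ * place c.out E * c.unitary).submatrix zeroExt zeroExt

/-- Heisenberg duality. It replaces the sums over traced-out wires in `run` by placements and one
compression, which compose well. -/
theorem trace_mul_run (c : Circuit G I O) (E : Matrix (Reg O) (Reg O) ℂ)
    (X : Matrix (Reg I) (Reg I) ℂ) : (E * c.run X).trace = (c.dual E * X).trace := by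
  obtain ⟨N, _, _, e, he⟩ := exists_splitting c.out
  rw [c.run_eq e he, LinearMap.comp_apply, trace_mul_traceOut, he, dual,
    ← conjTranspose_ancMat_mul_mul]
  simp only [LinearMap.comp_apply, conjMap, LinearMap.coe_mk, AddHom.coe_mk, ← Matrix.mul_assoc]
  rw [trace_mul_comm, ← Matrix.mul_assoc, ← Matrix.mul_assoc, trace_mul_comm]
  simp only [← Matrix.mul_assoc]

theorem dual_one {G : GateSet} {I O : Type} [Fintype I] [DecidableEq I] [Fintype O]
    (c : Circuit G I O) : c.dual 1 = 1 := by
  rw [dual, place_one, Matrix.mul_one, c.unitary_conjTranspose_mul]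
  ext i j
  simp only [submatrix_apply, one_apply, zeroExt, Sum.elim_eq_iff, and_true]

theorem isTP_run (c : Circuit G I O) : IsTP c.run := fun X => by
  have := c.trace_mul_run 1 X
  rwa [dual_one, Matrix.one_mul, Matrix.one_mul] at this

/-! ### Sequential composition -/

/-- The wires of a sequential composition. -/
def seqWires (I : Type) (m n : ℕ) : (I ⊕ Fin m) ⊕ Fin n ≃ I ⊕ Fin (m + n) :=
  (Equiv.sumAssoc I (Fin m) (Fin n)).trans ((Equiv.refl I).sumCongr finSumFinEquiv)

/-- The circuit `c`, followed by the circuit `c'`. -/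
def seq (c : Circuit G I O) (c' : Circuit G O K) : Circuit G I K where
  anc := c.anc + c'.anc
  gates := moveGates (Function.Embedding.inl.trans (seqWires I c.anc c'.anc).toEmbedding) c.gates ++
    moveGates ((withAnc (Fin c'.anc) c.out).trans (seqWires I c.anc c'.anc).toEmbedding) c'.gates
  out := c'.out.trans ((withAnc (Fin c'.anc) c.out).trans (seqWires I c.anc c'.anc).toEmbedding)

theorem size_seq {G : GateSet} {I O K : Type} (c : Circuit G I O) (c' : Circuit G O K) :
    (c.seq c').size = c.size + c'.size := by
  simp [size, seq, moveGates]

/-- The ancillas are compressed in two stages. Those of `c'` are untouched by the unitary of `c`, so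
compressing them first yields `c'.dual E` on the output wires of `c`; compressing those of `c` then
gives `c.dual`. -/
theorem dual_seq {G : GateSet} {I O K : Type} [Fintype I] [DecidableEq I] [Fintype O]
    [DecidableEq O] (c : Circuit G I O) (c' : Circuit G O K) (E : Matrix (Reg K) (Reg K) ℂ) :
    (c.seq c').dual E = c.dual (c'.dual E) := by
  set τ := seqWires I c.anc c'.anc
  have hU : (c.seq c').unitary = place τ.toEmbedding
      (place (withAnc (Fin c'.anc) c.out) c'.unitary * place Function.Embedding.inl c.unitary) := by
    rw [place_mul, place_place, place_place, unitary_eq, unitary_eq, unitary_eq,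
      ← gateProd_moveGates, ← gateProd_moveGates, ← gateProd_append]
    rfl
  have hO : place (c.seq c').out E =
      place τ.toEmbedding (place (withAnc (Fin c'.anc) c.out) (place c'.out E)) := by
    rw [place_place, place_place]
    rfl
  -- Adjoining all ancillas at once is adjoining those of `c` and then those of `c'`.
  have hz : ∀ i : Reg I, (zeroExt i : Reg (I ⊕ Fin (c.anc + c'.anc))) ∘ τ = zeroExt (zeroExt i) := by
    intro i
    funext w
    rcases w with (w | w) | w <;> rfl
  have h0 : (c.seq c').dual E =
      ((place τ.toEmbedding (place (withAnc (Fin c'.anc) c.out) c'.unitary *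
          place Function.Embedding.inl c.unitary))ᴴ *
        place τ.toEmbedding (place (withAnc (Fin c'.anc) c.out) (place c'.out E)) *
        place τ.toEmbedding (place (withAnc (Fin c'.anc) c.out) c'.unitary *
          place Function.Embedding.inl c.unitary)).submatrix
        (zeroExt : Reg I → Reg (I ⊕ Fin (c.anc + c'.anc))) zeroExt := by
    rw [dual, hU, hO]
    rfl
  rw [h0, ← place_conjTranspose, ← place_mul, ← place_mul, place_equiv_submatrix]
  simp only [hz, conjTranspose_mul, ← place_conjTranspose]
  rw [dual, dual]
  rw [← submatrix_place_withAnc c.out, ← submatrix_place_inl_mul_mul, place_mul, place_mul]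
  simp only [Matrix.mul_assoc]
  rfl

theorem run_seq (c : Circuit G I O) (c' : Circuit G O K) : (c.seq c').run = c'.run ∘ₗ c.run := by
  refine LinearMap.ext fun X => ext_of_trace_mul fun E => ?_
  rw [LinearMap.comp_apply, trace_mul_run, trace_mul_run, trace_mul_run, dual_seq]

/-! ### Idle wires -/

/-- The output wires of a circuit, together with idle wires `J`. -/
def outWith (c : Circuit G I O) (J : Type) : O ⊕ J ↪ (I ⊕ J) ⊕ Fin c.anc where
  toFun := Sum.elim (fun o => withAnc (Fin c.anc) Function.Embedding.inl (c.out o))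
    fun j => Sum.inl (Sum.inr j)
  inj' := by
    have h : ∀ o j, withAnc (Fin c.anc) (Function.Embedding.inl : I ↪ I ⊕ J) (c.out o) ≠
        Sum.inl (Sum.inr j) := fun o j => by
      rcases c.out o with x | x <;> simp [withAnc]
    rintro (o | j) (o' | j') hx
    · exact congrArg Sum.inl (c.out.injective ((withAnc _ _).injective hx))
    · exact (h _ _ hx).elim
    · exact (h _ _ hx.symm).elim
    · simpa using hx

/-- The circuit `c`, next to idle wires `J`. -/
def besides (c : Circuit G I O) (J : Type) : Circuit G (I ⊕ J) (O ⊕ J) where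
  anc := c.anc
  gates := moveGates (withAnc (Fin c.anc) Function.Embedding.inl) c.gates
  out := c.outWith J

theorem size_besides {G : GateSet} {I O : Type} (c : Circuit G I O) (J : Type) :
    (c.besides J).size = c.size := by
  simp [size, besides, moveGates]

/-- All wires of a circuit next to idle wires `J`. -/
def besidesWires (I J : Type) (n : ℕ) : (I ⊕ Fin n) ⊕ J ≃ (I ⊕ J) ⊕ Fin n where
  toFun := Sum.elim (Sum.elim (fun i => Sum.inl (Sum.inl i)) Sum.inr) fun j => Sum.inl (Sum.inr j)
  invFun := Sum.elim (Sum.elim (fun i => Sum.inl (Sum.inl i)) Sum.inr) fun j => Sum.inl (Sum.inr j)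
  left_inv := by rintro ((i | k) | j) <;> rfl
  right_inv := by rintro ((i | k) | j) <;> rfl

variable {J : Type} [Fintype J] [DecidableEq J]

/-- An observable on the idle wires commutes with the unitary of `c` and touches no ancilla, so it
factors out of both the conjugation and the compression. -/
theorem dual_besides (c : Circuit G I O) (E : Matrix (Reg O) (Reg O) ℂ)
    (F : Matrix (Reg J) (Reg J) ℂ) :
    (c.besides J).dual (relabel (joinReg O J) (E ⊗ₖ F)) =
      relabel (joinReg I J) (c.dual E ⊗ₖ F) := by
  set k : I ⊕ Fin c.anc ↪ (I ⊕ J) ⊕ Fin c.anc := withAnc (Fin c.anc) Function.Embedding.inl with hk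
  set j : J ↪ (I ⊕ J) ⊕ Fin c.anc := Function.Embedding.inr.trans Function.Embedding.inl
  have hU : (c.besides J).unitary = place k c.unitary := by
    rw [unitary_eq, unitary_eq, ← gateProd_moveGates]
    rfl
  have hO : place (c.besides J).out (relabel (joinReg O J) (E ⊗ₖ F)) =
      place k (place c.out E) * place j F := by
    rw [place_relabel_kronecker, place_place]
    rfl
  have hc : place j F * place k c.unitary = place k c.unitary * place j F := by
    have h1 : k = Function.Embedding.inl.trans (besidesWires I J c.anc).toEmbedding := by
      ext w
      rcases w with w | w <;> rfl
    have h2 : j = Function.Embedding.inr.trans (besidesWires I J c.anc).toEmbedding := rfl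
    rw [h1, h2, place_commute]
  have h0 : (c.besides J).dual (relabel (joinReg O J) (E ⊗ₖ F)) =
      ((place k c.unitary)ᴴ * (place k (place c.out E) * place j F) *
        place k c.unitary).submatrix zeroExt zeroExt := by
    rw [dual, hU, hO]
    rfl
  have h1 : (c.besides J).dual (relabel (joinReg O J) (E ⊗ₖ F)) =
      (place Function.Embedding.inl 1 * place k (c.unitaryᴴ * place c.out E * c.unitary) *
        place Function.Embedding.inl (place Function.Embedding.inr F)).submatrix
          zeroExt zeroExt := by
    rw [h0, ← place_conjTranspose, place_one, Matrix.one_mul, place_mul, place_mul,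
      place_place Function.Embedding.inl Function.Embedding.inr F]
    simp only [Matrix.mul_assoc]
    rw [hc]
  rw [h1, submatrix_place_inl_mul_mul, hk, submatrix_place_withAnc, Matrix.one_mul,
    relabel_joinReg_kronecker]
  rfl

theorem run_besides (c : Circuit G I O) :
    (c.besides J).run ∘ₗ relabel (joinReg I J) = relabel (joinReg O J) ∘ₗ amplR (Reg J) c.run := by
  refine linearMap_ext_kronecker fun X Y => ext_of_trace_mul fun E => ?_
  obtain ⟨E, rfl⟩ : ∃ E', E = relabel (joinReg O J) E' :=
    ⟨relabel (joinReg O J).symm E, by simp [relabel_apply]⟩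
  -- The pairing is also linear in the observable, so product observables suffice and `dual_besides`
  -- applies.
  let f : Matrix (Reg (O ⊕ J)) (Reg (O ⊕ J)) ℂ → Matrix (Reg O × Reg J) (Reg O × Reg J) ℂ →ₗ[ℂ] ℂ :=
    fun Z => traceLinearMap _ ℂ ℂ ∘ₗ LinearMap.mulRight ℂ Z ∘ₗ relabel (joinReg O J)
  suffices h : f ((c.besides J).run (relabel (joinReg I J) (X ⊗ₖ Y))) =
      f (relabel (joinReg O J) (amplR (Reg J) c.run (X ⊗ₖ Y))) from LinearMap.congr_fun h E
  have ht : ∀ (V : Type) [Fintype V] [DecidableEq V]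
      (A B : Matrix (Reg V × Reg J) (Reg V × Reg J) ℂ),
      (relabel (joinReg V J) A * relabel (joinReg V J) B).trace = (A * B).trace := by
    intro V _ _ A B
    rw [relabel_apply, relabel_apply, submatrix_mul_equiv]
    exact isTP_relabel (joinReg V J) (A * B)
  refine linearMap_ext_kronecker fun E F => ?_
  change (relabel (joinReg O J) (E ⊗ₖ F) * (c.besides J).run _).trace =
    (relabel (joinReg O J) (E ⊗ₖ F) * relabel (joinReg O J) _).trace
  rw [trace_mul_run, dual_besides, ht I, ht O, amplR_kronecker, ← mul_kronecker_mul,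
    ← mul_kronecker_mul, trace_kronecker, trace_kronecker, trace_mul_run]

/-! ### Discarded input wires -/

/-- The circuit `c` on a part of the input wires; the wires `N` are discarded. -/
def onPart {N I' : Type} (c : Circuit G I O) (e : I ⊕ N ≃ I') : Circuit G I' O where
  anc := c.anc
  gates := moveGates (withAnc (Fin c.anc) (Function.Embedding.inl.trans e.toEmbedding)) c.gates
  out := c.out.trans (withAnc (Fin c.anc) (Function.Embedding.inl.trans e.toEmbedding))

theorem size_onPart {G : GateSet} {I O N I' : Type} (c : Circuit G I O) (e : I ⊕ N ≃ I') :
    (c.onPart e).size = c.size := by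
  simp [size, onPart, moveGates]

/-- Dually, the discarded wires carry the identity on both sides. -/
theorem run_onPart {N I' : Type} [Fintype N] [DecidableEq N] [Fintype I'] [DecidableEq I']
    (c : Circuit G I O) (e : I ⊕ N ≃ I') : (c.onPart e).run = c.run ∘ₗ traceOut e := by
  refine LinearMap.ext fun X => ext_of_trace_mul fun E => ?_
  rw [LinearMap.comp_apply, trace_mul_run, trace_mul_run, trace_mul_traceOut]
  congr 2
  set k := withAnc (Fin c.anc) (Function.Embedding.inl.trans e.toEmbedding)
  have hU : (c.onPart e).unitary = place k c.unitary := by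
    rw [unitary_eq, unitary_eq, ← gateProd_moveGates]
    rfl
  have hO : place (c.onPart e).out E = place k (place c.out E) := by
    rw [place_place]
    rfl
  have h0 : (c.onPart e).dual E =
      ((place k c.unitary)ᴴ * place k (place c.out E) * place k c.unitary).submatrix
        zeroExt zeroExt := by
    rw [dual, hU, hO]
    rfl
  rw [h0, ← place_conjTranspose, ← place_mul, ← place_mul, dual, ← submatrix_place_withAnc]

end Circuit

/-! ## Complexity of a test after a decoder -/

theorem relabel_relabel_symm {a b : Type*} (e : a ≃ b) (X : Matrix b b ℂ) :
    relabel e (relabel e.symm X) = X := by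
  simp [relabel_apply]

theorem isCP_measureBit : IsCP measureBit := by
  have : measureBit = ∑ b : Bool,
      conjMap (Matrix.of fun i (s : Reg Unit) => if i = b ∧ s = fun _ => b then (1 : ℂ) else 0) := by
    refine LinearMap.ext fun X => ?_
    ext i j
    cases i <;> cases j <;>
      simp [measureBit, conjMap, mul_apply]
  rw [this]
  exact IsCP.sum _ fun _ => isCP_conjMap _

theorem diamondDist_comp_right_le {a b c : Type*} [Fintype a] [DecidableEq a] [Fintype b]
    [DecidableEq b] [Fintype c] [DecidableEq c] {P : OpMap a b} (hP : IsCP P) (hP' : IsTP P)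
    (Φ Ψ : OpMap b c) : diamondDist (Φ ∘ₗ P) (Ψ ∘ₗ P) ≤ diamondDist Φ Ψ := by
  refine iSup₂_le fun r ψ => ?_
  exact le_iSup₂ (f := fun (r : ℕ) (ψ : State (b × Fin r)) =>
    ((traceNorm (amplR (Fin r) Φ ψ.mat - amplR (Fin r) Ψ ψ.mat) : ℝ) : EReal)) r
    { mat := amplR (Fin r) P ψ.mat
      posSemidef := hP.amplR_posSemidef ψ.posSemidef
      trace_one := by rw [hP'.amplR (Fin r), ψ.trace_one] }

theorem exists_circuit_of_channelComplexity_ne_top {I O : Type} [Fintype I] [DecidableEq I]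
    [Fintype O] [DecidableEq O] {G : GateSet} {κ : ℝ} {Φ : OpMap (Reg I) (Reg O)}
    (h : channelComplexity G κ Φ ≠ ⊤) :
    ∃ c : Circuit G I O, diamondDist c.run Φ ≤ (κ : EReal) ∧
      channelComplexity G κ Φ = (c.size : ℕ∞) := by
  refine csInf_mem (s := {m : ℕ∞ | ∃ c : Circuit G I O, diamondDist c.run Φ ≤ (κ : EReal) ∧
    m = (c.size : ℕ∞)}) (Set.nonempty_iff_ne_empty.2 fun h0 => h ?_)
  rw [channelComplexity, h0, sInf_empty]

theorem exists_circuit_of_algComplexity_ne_top {I : Type} [Fintype I] [DecidableEq I]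
    {G : GateSet} {κ : ℝ} {𝒜 : OpMap (Reg I) Bool} (h : algComplexity G κ 𝒜 ≠ ⊤) :
    ∃ c : Circuit G I Unit, diamondDist (measureBit ∘ₗ c.run) 𝒜 ≤ (κ : EReal) ∧
      algComplexity G κ 𝒜 = (c.size : ℕ∞) := by
  refine csInf_mem (s := {m : ℕ∞ | ∃ c : Circuit G I Unit,
    diamondDist (measureBit ∘ₗ c.run) 𝒜 ≤ (κ : EReal) ∧ m = (c.size : ℕ∞)})
    (Set.nonempty_iff_ne_empty.2 fun h0 => h ?_)
  rw [algComplexity, h0, sInf_empty]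

/-- The test `T`, applied to the output of the decoder `D` and to the wires `J`; the input wires
`N` are discarded. -/
noncomputable def decodeAndTest {I O J N I' : Type} [Fintype N] [DecidableEq N]
    (e : (I ⊕ J) ⊕ N ≃ I') (D : OpMap (Reg I) (Reg O)) (T : OpMap (Reg (O ⊕ J)) Bool) :
    OpMap (Reg I') Bool :=
  (T ∘ₗ relabel (joinReg O J)) ∘ₗ amplR (Reg J) D ∘ₗ (relabel (joinReg I J).symm ∘ₗ traceOut e)

/-- Optimal circuits for `D` and `T` are joined: the first runs beside the idle wires `J`, the
second on all its outputs. Idling, rerouting and discarding wires use no gates. -/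
theorem algComplexity_decodeAndTest_le {I O J N I' : Type} [Fintype I] [DecidableEq I] [Fintype O]
    [DecidableEq O] [Fintype J] [DecidableEq J] [Fintype N] [DecidableEq N] [Fintype I']
    [DecidableEq I'] (G : GateSet) {κ κD κT : ℝ} (hκ : κD + κT ≤ κ) (e : (I ⊕ J) ⊕ N ≃ I')
    {D : OpMap (Reg I) (Reg O)} (hD : IsCP D) {T : OpMap (Reg (O ⊕ J)) Bool} (hT : IsCP T)
    (hT' : IsTP T) :
    algComplexity G κ (decodeAndTest e D T) ≤
      channelComplexity G κD D + algComplexity G κT T := by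
  by_cases h1 : channelComplexity G κD D = ⊤
  · simp [h1]
  by_cases h2 : algComplexity G κT T = ⊤
  · simp [h2]
  obtain ⟨c, hc, hs⟩ := exists_circuit_of_channelComplexity_ne_top h1
  obtain ⟨c', hc', hs'⟩ := exists_circuit_of_algComplexity_ne_top h2
  rw [hs, hs']
  refine sInf_le ⟨((c.besides J).seq c').onPart e, ?_, ?_⟩
  · have hrun : measureBit ∘ₗ (((c.besides J).seq c').onPart e).run =
        ((measureBit ∘ₗ c'.run) ∘ₗ relabel (joinReg O J)) ∘ₗ amplR (Reg J) c.run ∘ₗ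
          (relabel (joinReg I J).symm ∘ₗ traceOut e) := by
      rw [Circuit.run_onPart, Circuit.run_seq]
      refine LinearMap.ext fun X => ?_
      have h := LinearMap.congr_fun (c.run_besides (J := J))
        (relabel (joinReg I J).symm (traceOut e X))
      rw [LinearMap.comp_apply, relabel_relabel_symm] at h
      exact congrArg (fun Z => measureBit (c'.run Z)) h
    rw [hrun]
    refine (diamondDist_comp_le ((isCP_relabel _).comp (isCP_traceOut e))
      ((isTP_relabel _).comp (isTP_traceOut e)) c.isCP_run c.isTP_run hD
      ((isCP_measureBit.comp c'.isCP_run).comp (isCP_relabel _)) (hT.comp (isCP_relabel _))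
      (hT'.comp (isTP_relabel _)) hc
      ((diamondDist_comp_right_le (isCP_relabel _) (isTP_relabel _) _ _).trans hc')).trans ?_
    exact_mod_cast hκ
  · rw [Circuit.size_onPart, Circuit.size_seq, Circuit.size_besides]
    push_cast
    rfl

/-! ## A lower bound on the mutual information -/

/-- The classical core, for the Nussbaum–Szkoła weights `p = l i * W i j k` and `r = a j * b k * W i
j k`. By the marginal conditions the right-hand side is the relative entropy of `p` with respect to
`r`, and the sum bounded by `c` is their overlap `∑ √(p r)`. -/
theorem neg_two_mul_log_le_sum_negMulLog {ι α β : Type*} [Fintype ι] [Fintype α] [Fintype β]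
    {l : ι → ℝ} {a : α → ℝ} {b : β → ℝ} {W : ι → α → β → ℝ}
    (hl : ∀ i, 0 ≤ l i) (hW : ∀ i j k, 0 ≤ W i j k)
    (ha : ∀ j, ∑ k, ∑ i, l i * W i j k = a j) (hb : ∀ k, ∑ j, ∑ i, l i * W i j k = b k)
    (hW1 : ∀ i, ∑ j, ∑ k, W i j k = 1) (hl1 : ∑ i, l i = 1) {c : ℝ} (hc : 0 < c)
    (hF : ∑ i, ∑ j, ∑ k, √(l i) * (√(a j) * √(b k)) * W i j k ≤ c) :
    -2 * Real.log c ≤ ∑ j, Real.negMulLog (a j) + ∑ k, Real.negMulLog (b k) -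
      ∑ i, Real.negMulLog (l i) := by
  have term : ∀ i j k, l i * W i j k * (-2 * Real.log c + 2) -
      2 / c * (√(l i) * (√(a j) * √(b k)) * W i j k) ≤
      l i * W i j k * (Real.log (l i) - Real.log (a j) - Real.log (b k)) := by
    intro i j k
    rcases (hl i).eq_or_lt with h0 | hli
    · simp [← h0]
    rcases (hW i j k).eq_or_lt with h0 | hw
    · simp [← h0]
    have hpos : 0 < l i * W i j k := mul_pos hli hw
    have haj : 0 < a j := by
      rw [← ha j]
      refine lt_of_lt_of_le hpos ?_
      refine (Finset.single_le_sum (f := fun i => l i * W i j k)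
        (fun i _ => mul_nonneg (hl i) (hW i j k)) (Finset.mem_univ i)).trans ?_
      exact Finset.single_le_sum (f := fun k => ∑ i, l i * W i j k)
        (fun k _ => Finset.sum_nonneg fun i _ => mul_nonneg (hl i) (hW i j k)) (Finset.mem_univ k)
    have hbk : 0 < b k := by
      rw [← hb k]
      refine lt_of_lt_of_le hpos ?_
      refine (Finset.single_le_sum (f := fun i => l i * W i j k)
        (fun i _ => mul_nonneg (hl i) (hW i j k)) (Finset.mem_univ i)).trans ?_
      exact Finset.single_le_sum (f := fun j => ∑ i, l i * W i j k)
        (fun j _ => Finset.sum_nonneg fun i _ => mul_nonneg (hl i) (hW i j k)) (Finset.mem_univ j)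
    have s1 := Real.sqrt_pos.2 hli
    have s2 := Real.sqrt_pos.2 haj
    have s3 := Real.sqrt_pos.2 hbk
    -- The inequality `ln u ≤ u - 1` at the square root of the likelihood ratio, divided by `c`;
    -- this scaling makes the linear terms sum to at most `2`, cancelling the `+ 2` in `term`.
    have hlog := Real.log_le_sub_one_of_pos
      (show 0 < √(a j) * √(b k) / (√(l i) * c) by positivity)
    rw [Real.log_div (by positivity) (by positivity), Real.log_mul s2.ne' s3.ne',
      Real.log_mul s1.ne' hc.ne', Real.log_sqrt haj.le, Real.log_sqrt hbk.le,
      Real.log_sqrt hli.le] at hlog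
    have e : √(l i) * (√(a j) * √(b k)) * W i j k =
        l i * W i j k * (√(a j) * √(b k) / (√(l i) * c)) * c := by
      have := Real.mul_self_sqrt hli.le
      field_simp
      rw [sq, this]
    rw [e]
    have e' : 2 / c * (l i * W i j k * (√(a j) * √(b k) / (√(l i) * c)) * c) =
        l i * W i j k * (2 * (√(a j) * √(b k) / (√(l i) * c))) := by
      field_simp
    rw [e', ← mul_sub]
    refine mul_le_mul_of_nonneg_left ?_ hpos.le
    linarith
  have hsum := Finset.sum_le_sum fun i (_ : i ∈ Finset.univ) => Finset.sum_le_sum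
    fun j (_ : j ∈ Finset.univ) => Finset.sum_le_sum fun k (_ : k ∈ Finset.univ) => term i j k
  have hL : ∑ i, ∑ j, ∑ k, (l i * W i j k * (-2 * Real.log c + 2) -
      2 / c * (√(l i) * (√(a j) * √(b k)) * W i j k)) = (-2 * Real.log c + 2) -
      2 / c * ∑ i, ∑ j, ∑ k, √(l i) * (√(a j) * √(b k)) * W i j k := by
    simp only [Finset.sum_sub_distrib, ← Finset.mul_sum, ← Finset.sum_mul, hW1, mul_one, hl1,
      one_mul]
  have eA : ∑ i, ∑ j, ∑ k, l i * W i j k * Real.log (a j) = ∑ j, a j * Real.log (a j) := by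
    rw [Finset.sum_comm]
    refine Finset.sum_congr rfl fun j _ => ?_
    rw [Finset.sum_comm]
    simp only [← Finset.sum_mul, ha]
  have eB : ∑ i, ∑ j, ∑ k, l i * W i j k * Real.log (b k) = ∑ k, b k * Real.log (b k) := by
    rw [Finset.sum_congr rfl fun i _ => Finset.sum_comm, Finset.sum_comm]
    refine Finset.sum_congr rfl fun k _ => ?_
    rw [Finset.sum_comm]
    simp only [← Finset.sum_mul, hb]
  have eL : ∑ i, ∑ j, ∑ k, l i * W i j k * Real.log (l i) = ∑ i, l i * Real.log (l i) := by
    simp only [← Finset.mul_sum, ← Finset.sum_mul, hW1, mul_one]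
  simp only [mul_sub, Finset.sum_sub_distrib] at hsum hL
  rw [hL, eA, eB, eL] at hsum
  simp only [Real.negMulLog, neg_mul, Finset.sum_neg_distrib]
  have : 2 / c * ∑ i, ∑ j, ∑ k, √(l i) * (√(a j) * √(b k)) * W i j k ≤ 2 := by
    rw [div_mul_eq_mul_div, div_le_iff₀ hc]
    linarith
  linarith

/-- Cauchy–Schwarz: the quadratic polynomial `x ↦ g ((x R + S)²)` is nonnegative in its real part,
so its discriminant is at most zero. -/
theorem re_add_le_two_mul_sqrt {a : Type*} [Fintype a] {g : Matrix a a ℂ →ₗ[ℂ] ℂ}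
    (hg : ∀ X : Matrix a a ℂ, X.PosSemidef → 0 ≤ (g X).re) {R S : Matrix a a ℂ}
    (hR : R.IsHermitian) (hS : S.IsHermitian) :
    (g (R * S)).re + (g (S * R)).re ≤ 2 * √((g (R * R)).re * (g (S * S)).re) := by
  have h : ∀ x : ℝ, 0 ≤ (g (R * R)).re * (x * x) + ((g (R * S)).re + (g (S * R)).re) * x +
      (g (S * S)).re := by
    intro x
    have hH : ((x : ℂ) • R + S).IsHermitian := by
      rw [IsHermitian, conjTranspose_add, conjTranspose_smul, hR.eq, hS.eq]
      simp
    have h1 := hg _ (posSemidef_self_mul_conjTranspose ((x : ℂ) • R + S))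
    rw [hH.eq] at h1
    simp only [Matrix.mul_add, Matrix.add_mul, map_add, Matrix.smul_mul, Matrix.mul_smul, map_smul,
      smul_eq_mul, Complex.add_re, Complex.re_ofReal_mul] at h1
    linarith
  have h2 := discrim_le_zero h
  rw [discrim] at h2
  refine le_of_abs_le ?_
  have h3 : 2 * √((g (R * R)).re * (g (S * S)).re) =
      √(4 * ((g (R * R)).re * (g (S * S)).re)) := by
    rw [Real.sqrt_mul (by norm_num : (0 : ℝ) ≤ 4), show (4 : ℝ) = 2 ^ 2 by norm_num,
      Real.sqrt_sq (by norm_num : (0 : ℝ) ≤ 2)]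
  rw [h3]
  refine Real.abs_le_sqrt ?_
  linarith

/-- Meant for `R = √ρ`, `S = √σ`. With `p = g ρ` and `q = g σ`, Cauchy–Schwarz for `g` and for `tr -
g` bounds the overlap by `√(p q) + √((1 - p) (1 - q)) ≤ √q + √(1 - p)`, and the square of this sum
is at most `2 (q + 1 - p)`. -/
theorem re_trace_mul_le {a : Type*} [Fintype a] {g : Matrix a a ℂ →ₗ[ℂ] ℂ}
    (hg : ∀ X : Matrix a a ℂ, X.PosSemidef → 0 ≤ g X ∧ g X ≤ X.trace) {R S : Matrix a a ℂ}
    (hR : R.IsHermitian) (hS : S.IsHermitian) (hR1 : (R * R).trace = 1)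
    (hS1 : (S * S).trace = 1) {η : ℝ} (hη : 1 - (g (R * R)).re + (g (S * S)).re ≤ η) :
    (R * S).trace.re ≤ √(2 * η) := by
  have h1 := re_add_le_two_mul_sqrt (g := g)
    (fun X hX => (Complex.le_def.1 (hg X hX).1).1) hR hS
  have h2 := re_add_le_two_mul_sqrt (g := traceLinearMap a ℂ ℂ - g)
    (fun X hX => by
      have := (Complex.le_def.1 (hg X hX).2).1
      simpa using this) hR hS
  simp only [LinearMap.sub_apply, traceLinearMap_apply, Complex.sub_re, hR1, hS1,
    Complex.one_re, trace_mul_comm S R] at h2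
  have pR := hg _ (by
    simpa only [hR.eq] using posSemidef_self_mul_conjTranspose R : (R * R).PosSemidef)
  have pS := hg _ (by
    simpa only [hS.eq] using posSemidef_self_mul_conjTranspose S : (S * S).PosSemidef)
  rw [hR1] at pR
  rw [hS1] at pS
  have r1 := (Complex.le_def.1 pR.1).1
  have r2 := (Complex.le_def.1 pR.2).1
  have s1 := (Complex.le_def.1 pS.1).1
  have s2 := (Complex.le_def.1 pS.2).1
  simp only [Complex.zero_re, Complex.one_re] at r1 r2 s1 s2
  set p := (g (R * R)).re
  set q := (g (S * S)).re
  have i1 : √(p * q) ≤ √q := Real.sqrt_le_sqrt (mul_le_of_le_one_left s1 r2)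
  have i2 : √((1 - p) * (1 - q)) ≤ √(1 - p) :=
    Real.sqrt_le_sqrt (mul_le_of_le_one_right (by linarith) (by linarith))
  have i3 : √q + √(1 - p) ≤ √(2 * η) := by
    refine Real.le_sqrt_of_sq_le ?_
    have e1 := Real.sq_sqrt s1
    have e2 := Real.sq_sqrt (show 0 ≤ 1 - p by linarith)
    nlinarith [sq_nonneg (√q - √(1 - p))]
  linarith

theorem trace_kronecker_one_mul {a b : Type*} [Fintype a] [DecidableEq a] [Fintype b]
    [DecidableEq b] (ρ : State (a × b)) (X : Matrix a a ℂ) :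
    ((X ⊗ₖ (1 : Matrix b b ℂ)) * ρ.mat).trace = (X * ρ.fst.mat).trace := by
  simp only [Matrix.trace, diag_apply, mul_apply, Fintype.sum_prod_type, kroneckerMap_apply,
    one_apply, mul_ite, mul_one, mul_zero, ite_mul, zero_mul, Finset.sum_ite_eq, Finset.mem_univ,
    if_true, State.fst, Matrix.sum_apply, submatrix_apply, Finset.mul_sum]

theorem trace_one_kronecker_mul {a b : Type*} [Fintype a] [DecidableEq a] [Fintype b]
    [DecidableEq b] (ρ : State (a × b)) (X : Matrix b b ℂ) :
    (((1 : Matrix a a ℂ) ⊗ₖ X) * ρ.mat).trace = (X * ρ.snd.mat).trace := by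
  simp only [Matrix.trace, diag_apply, mul_apply, Fintype.sum_prod_type, kroneckerMap_apply,
    one_apply, ite_mul, one_mul, zero_mul, State.snd, Matrix.sum_apply, submatrix_apply,
    Finset.mul_sum]
  rw [Finset.sum_comm]
  refine Finset.sum_congr rfl fun i _ => ?_
  rw [Finset.sum_comm]
  simp

theorem State.sum_eigenvalues {a : Type*} [Fintype a] [DecidableEq a] (ρ : State a) :
    ∑ i, ρ.posSemidef.isHermitian.eigenvalues i = 1 := by
  have h := ρ.posSemidef.isHermitian.trace_eq_sum_eigenvalues
  rw [ρ.trace_one] at h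
  have := congrArg Complex.re h
  simpa using this.symm

/-- If a two-outcome measurement distinguishes a state from the product of its marginals, then its
mutual information is large. -/
theorem State.neg_log_sub_one_le_mutualInfo {a b : Type*} [Fintype a] [DecidableEq a] [Fintype b]
    [DecidableEq b] (ρ : State (a × b)) {g : Matrix (a × b) (a × b) ℂ →ₗ[ℂ] ℂ}
    (hg : ∀ X : Matrix (a × b) (a × b) ℂ, X.PosSemidef → 0 ≤ g X ∧ g X ≤ X.trace) {η : ℝ}
    (hη : 0 < η) (h : 1 - (g ρ.mat).re + (g (ρ.fst.mat ⊗ₖ ρ.snd.mat)).re ≤ η) :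
    -Real.log η - 1 ≤ ρ.mutualInfo := by
  obtain ⟨U, hU, hU', eU⟩ := exists_unitary_diagonalization ρ.posSemidef.isHermitian
  obtain ⟨UA, hA, hA', eA⟩ := exists_unitary_diagonalization ρ.fst.posSemidef.isHermitian
  obtain ⟨UB, hB, hB', eB⟩ := exists_unitary_diagonalization ρ.snd.posSemidef.isHermitian
  have hl0 := ρ.posSemidef.eigenvalues_nonneg
  have ha0 := ρ.fst.posSemidef.eigenvalues_nonneg
  have hb0 := ρ.snd.posSemidef.eigenvalues_nonneg
  have hl1 := ρ.sum_eigenvalues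
  rw [State.mutualInfo, State.entropy, State.entropy, State.entropy]
  set l := ρ.posSemidef.isHermitian.eigenvalues
  set α := ρ.fst.posSemidef.isHermitian.eigenvalues
  set β := ρ.snd.posSemidef.isHermitian.eigenvalues
  set T : Matrix (a × b) (a × b) ℂ := UA ⊗ₖ UB with hT
  have hTT : Tᴴ * T = 1 := by
    rw [hT, conjTranspose_kronecker, ← mul_kronecker_mul, hA, hB, one_kronecker_one]
  have hTT' : T * Tᴴ = 1 := by
    rw [hT, conjTranspose_kronecker, ← mul_kronecker_mul, hA', hB', one_kronecker_one]
  -- Overlaps between the eigenbasis of `ρ` and the product eigenbasis of its marginals; their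
  -- squared moduli are the weights `W`.
  set V : Matrix (a × b) (a × b) ℂ := Uᴴ * T with hV
  have hVV : V * Vᴴ = 1 := by
    rw [hV, conjTranspose_mul, conjTranspose_conjTranspose, Matrix.mul_assoc,
      ← Matrix.mul_assoc T, hTT', Matrix.one_mul, hU]
  have diagW : ∀ x, (Tᴴ * ρ.mat * T) x x = ((∑ i, l i * Complex.normSq (V i x) : ℝ) : ℂ) := by
    intro x
    have : Tᴴ * ρ.mat * T = Vᴴ * diagonal (fun i => (l i : ℂ)) * V := by
      rw [eU, hV, conjTranspose_mul, conjTranspose_conjTranspose]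
      simp only [Matrix.mul_assoc]
    rw [this, mul_apply]
    push_cast
    refine Finset.sum_congr rfl fun i _ => ?_
    rw [mul_diagonal, conjTranspose_apply, Complex.normSq_eq_conj_mul_self]
    simp only [Complex.star_def]
    ring
  -- By `diagW` the inner sum is a diagonal entry of `ρ` in the product eigenbasis; summing over `k`
  -- leaves an entry of `ρ_A` in its own eigenbasis.
  have margA : ∀ j, ∑ k, ∑ i, l i * Complex.normSq (V i (j, k)) = α j := by
    intro j
    have e1 : ((single j j 1 ⊗ₖ (1 : Matrix b b ℂ)) * (Tᴴ * ρ.mat * T)).trace =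
        ∑ k, (Tᴴ * ρ.mat * T) (j, k) (j, k) := by
      simp [Matrix.trace, mul_apply, Fintype.sum_prod_type, one_apply, single_apply, ite_and]
    have e2 : ((single j j 1 ⊗ₖ (1 : Matrix b b ℂ)) * (Tᴴ * ρ.mat * T)).trace =
        (((UA * single j j 1 * UAᴴ) ⊗ₖ (1 : Matrix b b ℂ)) * ρ.mat).trace := by
      have : (UA * single j j 1 * UAᴴ) ⊗ₖ (1 : Matrix b b ℂ) =
          T * (single j j 1 ⊗ₖ (1 : Matrix b b ℂ)) * Tᴴ := by
        rw [hT, conjTranspose_kronecker, ← mul_kronecker_mul, ← mul_kronecker_mul, Matrix.mul_one,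
          hB']
      rw [this, ← Matrix.mul_assoc, trace_mul_comm]
      simp only [Matrix.mul_assoc]
    have e3 : (UA * single j j 1 * UAᴴ * ρ.fst.mat).trace = (α j : ℂ) := by
      rw [eA]
      have : UA * single j j 1 * UAᴴ * (UA * diagonal (fun i => (α i : ℂ)) * UAᴴ) =
          UA * (single j j 1 * diagonal (fun i => (α i : ℂ))) * UAᴴ := by
        simp only [Matrix.mul_assoc]
        rw [← Matrix.mul_assoc UAᴴ, hA, Matrix.one_mul]
      rw [this, trace_mul_comm, ← Matrix.mul_assoc, hA, Matrix.one_mul, trace_single_mul]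
      simp
    rw [e2, trace_kronecker_one_mul, e3] at e1
    simp only [diagW] at e1
    exact_mod_cast e1.symm
  have margB : ∀ k, ∑ j, ∑ i, l i * Complex.normSq (V i (j, k)) = β k := by
    intro k
    have e1 : (((1 : Matrix a a ℂ) ⊗ₖ single k k 1) * (Tᴴ * ρ.mat * T)).trace =
        ∑ j, (Tᴴ * ρ.mat * T) (j, k) (j, k) := by
      simp [Matrix.trace, mul_apply, Fintype.sum_prod_type, one_apply, single_apply, ite_and]
    have e2 : (((1 : Matrix a a ℂ) ⊗ₖ single k k 1) * (Tᴴ * ρ.mat * T)).trace =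
        (((1 : Matrix a a ℂ) ⊗ₖ (UB * single k k 1 * UBᴴ)) * ρ.mat).trace := by
      have : (1 : Matrix a a ℂ) ⊗ₖ (UB * single k k 1 * UBᴴ) =
          T * ((1 : Matrix a a ℂ) ⊗ₖ single k k 1) * Tᴴ := by
        rw [hT, conjTranspose_kronecker, ← mul_kronecker_mul, ← mul_kronecker_mul, Matrix.mul_one,
          hA']
      rw [this, ← Matrix.mul_assoc, trace_mul_comm]
      simp only [Matrix.mul_assoc]
    have e3 : (UB * single k k 1 * UBᴴ * ρ.snd.mat).trace = (β k : ℂ) := by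
      rw [eB]
      have : UB * single k k 1 * UBᴴ * (UB * diagonal (fun i => (β i : ℂ)) * UBᴴ) =
          UB * (single k k 1 * diagonal (fun i => (β i : ℂ))) * UBᴴ := by
        simp only [Matrix.mul_assoc]
        rw [← Matrix.mul_assoc UBᴴ, hB, Matrix.one_mul]
      rw [this, trace_mul_comm, ← Matrix.mul_assoc, hB, Matrix.one_mul, trace_single_mul]
      simp
    rw [e2, trace_one_kronecker_mul, e3] at e1
    simp only [diagW] at e1
    exact_mod_cast e1.symm
  have rowW : ∀ i, ∑ j, ∑ k, Complex.normSq (V i (j, k)) = 1 := by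
    intro i
    have := congrFun (congrFun hVV i) i
    rw [mul_apply, one_apply_eq] at this
    simp only [conjTranspose_apply, Complex.star_def, Complex.mul_conj, Fintype.sum_prod_type]
      at this
    exact_mod_cast this
  -- `R` and `S` are the positive square roots of `ρ` and `ρ_A ⊗ ρ_B`.
  set R : Matrix (a × b) (a × b) ℂ := U * diagonal (fun i => ((√(l i) : ℝ) : ℂ)) * Uᴴ with hR
  set S : Matrix (a × b) (a × b) ℂ :=
    T * diagonal (fun x => ((√(α x.1) * √(β x.2) : ℝ) : ℂ)) * Tᴴ with hS
  have hRR : R * R = ρ.mat := by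
    rw [hR, eU]
    have : ∀ D : Matrix (a × b) (a × b) ℂ, U * D * Uᴴ * (U * D * Uᴴ) = U * (D * D) * Uᴴ := by
      intro D
      simp only [Matrix.mul_assoc]
      rw [← Matrix.mul_assoc Uᴴ, hU, Matrix.one_mul]
    rw [this, diagonal_mul_diagonal]
    congr 3
    funext i
    rw [← Complex.ofReal_mul, Real.mul_self_sqrt (hl0 i)]
  have hSS : S * S = ρ.fst.mat ⊗ₖ ρ.snd.mat := by
    rw [hS, eA, eB]
    have : ∀ D : Matrix (a × b) (a × b) ℂ, T * D * Tᴴ * (T * D * Tᴴ) = T * (D * D) * Tᴴ := by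
      intro D
      simp only [Matrix.mul_assoc]
      rw [← Matrix.mul_assoc Tᴴ, hTT, Matrix.one_mul]
    rw [this, diagonal_mul_diagonal, mul_kronecker_mul, mul_kronecker_mul,
      diagonal_kronecker_diagonal, hT, conjTranspose_kronecker]
    congr 3
    funext x
    rw [← Complex.ofReal_mul, ← Complex.ofReal_mul, mul_mul_mul_comm, Real.mul_self_sqrt (ha0 _),
      Real.mul_self_sqrt (hb0 _)]
  have hF : (R * S).trace.re =
      ∑ i, ∑ j, ∑ k, √(l i) * (√(α j) * √(β k)) * Complex.normSq (V i (j, k)) := by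
    have : (R * S).trace = (diagonal (fun i => ((√(l i) : ℝ) : ℂ)) *
        (V * diagonal (fun x : a × b => ((√(α x.1) * √(β x.2) : ℝ) : ℂ)) * Vᴴ)).trace := by
      rw [hR, hS, hV, conjTranspose_mul, conjTranspose_conjTranspose, Matrix.mul_assoc U,
        Matrix.mul_assoc U, trace_mul_comm]
      simp only [Matrix.mul_assoc]
    rw [this, Matrix.trace, Complex.re_sum]
    refine Finset.sum_congr rfl fun i _ => ?_
    rw [diag_apply, diagonal_mul, Complex.re_ofReal_mul, mul_apply, Complex.re_sum,
      Finset.mul_sum, Fintype.sum_prod_type]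
    refine Finset.sum_congr rfl fun j _ => Finset.sum_congr rfl fun k _ => ?_
    rw [mul_diagonal, conjTranspose_apply, Complex.star_def, mul_right_comm, Complex.mul_conj,
      ← Complex.ofReal_mul, Complex.ofReal_re]
    ring
  have hRH : R.IsHermitian :=
    (posSemidef_unitary_diagonal U fun i => Real.sqrt_nonneg _).isHermitian
  have hSH : S.IsHermitian :=
    (posSemidef_unitary_diagonal T fun x =>
      mul_nonneg (Real.sqrt_nonneg (α x.1)) (Real.sqrt_nonneg (β x.2))).isHermitian
  have hle := re_trace_mul_le hg hRH hSH (by rw [hRR, ρ.trace_one])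
    (by rw [hSS, trace_kronecker, ρ.fst.trace_one, ρ.snd.trace_one, one_mul])
    (η := η) (by rwa [hRR, hSS])
  rw [hF] at hle
  have key := neg_two_mul_log_le_sum_negMulLog hl0 (fun i j k => Complex.normSq_nonneg (V i (j, k)))
    margA margB rowW hl1 (Real.sqrt_pos.2 (by positivity : 0 < 2 * η)) hle
  rw [Real.log_sqrt (by positivity), Real.log_mul (by norm_num) hη.ne'] at key
  -- Since `-2 ln √(2η) = -ln η - ln 2`, the additive loss is really `ln 2`, rounded up to `1`.
  have : Real.log 2 ≤ 1 := by linarith [Real.log_two_lt_d9]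
  linarith

/-! ## Projective tests -/

/-- The expectation value of the operator `P`. -/
noncomputable def expect {a : Type*} [Fintype a] (P : Matrix a a ℂ) : Matrix a a ℂ →ₗ[ℂ] ℂ :=
  traceLinearMap a ℂ ℂ ∘ₗ LinearMap.mulLeft ℂ P

theorem expect_apply {a : Type*} [Fintype a] (P X : Matrix a a ℂ) :
    expect P X = (P * X).trace := rfl

theorem vecMulVec_mul_self {a : Type*} [Fintype a] {v : a → ℂ} (hv : star v ⬝ᵥ v = 1) :
    vecMulVec v (star v) * vecMulVec v (star v) = vecMulVec v (star v) := by
  rw [vecMulVec_mul_vecMulVec, hv]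
  simp

theorem trace_proj_mul {a : Type*} [Fintype a] {P : Matrix a a ℂ} (hP : P * P = P)
    (X : Matrix a a ℂ) :
    (P * X).trace = (P * X * P).trace := by
  rw [trace_mul_comm (P * X), ← Matrix.mul_assoc, hP]

theorem expect_bounds {a : Type*} [Fintype a] [DecidableEq a] {P : Matrix a a ℂ}
    (hP : P * P = P) (hP' : P.IsHermitian) {X : Matrix a a ℂ} (hX : X.PosSemidef) : 0 ≤ expect P X ∧ expect P X ≤ X.trace := by
  have h1 : ∀ {Q : Matrix a a ℂ}, Q * Q = Q → Q.IsHermitian → 0 ≤ (Q * X).trace := by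
    intro Q hQ hQ'
    rw [trace_proj_mul hQ]
    have := (hX.mul_mul_conjTranspose_same Q).trace_nonneg
    rwa [hQ'.eq] at this
  refine ⟨h1 hP hP', ?_⟩
  have h2 := h1 (Q := 1 - P) (by simp [Matrix.mul_sub, Matrix.sub_mul, hP])
    (isHermitian_one.sub hP')
  rwa [Matrix.sub_mul, Matrix.one_mul, trace_sub, sub_nonneg] at h2

theorem IsTP.amplL {a b : Type*} [Fintype a] [Fintype b] (r : Type*) [Fintype r] {Φ : OpMap a b}
    (hΦ : IsTP Φ) : IsTP (amplL r Φ) :=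
  (isTP_relabel (Equiv.prodComm b r)).comp
    ((hΦ.amplR r).comp (isTP_relabel (Equiv.prodComm r a)))

theorem isCP_tensorMap {a b c e : Type*} [Fintype b] [Fintype c] {Φ : OpMap a b} {Ψ : OpMap c e}
    (hΦ : IsCP Φ) (hΨ : IsCP Ψ) : IsCP (tensorMap Φ Ψ) := (hΨ.amplL b).comp (hΦ.amplR c)

theorem isTP_tensorMap {a b c e : Type*} [Fintype a] [Fintype b] [Fintype c] [Fintype e]
    {Φ : OpMap a b} {Ψ : OpMap c e} (hΦ : IsTP Φ) (hΨ : IsTP Ψ) : IsTP (tensorMap Φ Ψ) :=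
  (hΨ.amplL b).comp (hΦ.amplR c)

theorem tensorMap_kronecker {a b c e : Type*} (Φ : OpMap a b) (Ψ : OpMap c e) (X : Matrix a a ℂ)
    (Y : Matrix c c ℂ) : tensorMap Φ Ψ (X ⊗ₖ Y) = Φ X ⊗ₖ Ψ Y := by
  rw [tensorMap, LinearMap.comp_apply, amplR_kronecker, amplL_kronecker]

/-! ## The maximally entangled state -/

/-- The maximally entangled vector `d^{-1/2} ∑ i, |i⟩|i⟩`. -/
noncomputable def entVec (d : ℕ) : Fin d × Fin d → ℂ :=
  fun x => if x.1 = x.2 then ((√(d : ℝ) : ℝ) : ℂ)⁻¹ else 0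

theorem inv_sqrt_mul_self (d : ℕ) :
    ((√(d : ℝ) : ℝ) : ℂ)⁻¹ * ((√(d : ℝ) : ℝ) : ℂ)⁻¹ = (d : ℂ)⁻¹ := by
  rw [← mul_inv, ← Complex.ofReal_mul, Real.mul_self_sqrt (Nat.cast_nonneg d)]
  simp

theorem entVec_dotProduct {d : ℕ} (hd : 0 < d) : star (entVec d) ⬝ᵥ entVec d = 1 := by
  have : (d : ℂ) ≠ 0 := by exact_mod_cast hd.ne'
  simp [dotProduct, Fintype.sum_prod_type, entVec, apply_ite, inv_sqrt_mul_self, this]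

/-- The projector onto the maximally entangled vector. -/
noncomputable def entProj (d : ℕ) : Matrix (Fin d × Fin d) (Fin d × Fin d) ℂ :=
  vecMulVec (entVec d) (star (entVec d))

theorem entProj_apply (d : ℕ) (x y : Fin d × Fin d) :
    entProj d x y = if x.1 = x.2 ∧ y.1 = y.2 then (d : ℂ)⁻¹ else 0 := by
  rw [entProj, vecMulVec_apply, Pi.star_apply, entVec, entVec, ← inv_sqrt_mul_self]
  split_ifs <;> simp_all

theorem posSemidef_entProj (d : ℕ) : (entProj d).PosSemidef := posSemidef_vecMulVec_self_star _

theorem entProj_mul_self {d : ℕ} (hd : 0 < d) : entProj d * entProj d = entProj d :=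
  vecMulVec_mul_self (entVec_dotProduct hd)

theorem trace_entProj {d : ℕ} (hd : 0 < d) : (entProj d).trace = 1 := by
  rw [entProj, trace_vecMulVec, dotProduct_comm, entVec_dotProduct hd]

theorem expect_entProj_bounds {d : ℕ} (hd : 0 < d) {X : Matrix (Fin d × Fin d) (Fin d × Fin d) ℂ}
    (hX : X.PosSemidef) : 0 ≤ expect (entProj d) X ∧ expect (entProj d) X ≤ X.trace :=
  expect_bounds (entProj_mul_self hd) (posSemidef_entProj d).isHermitian hX

theorem expect_entProj (d : ℕ) (X : Matrix (Fin d × Fin d) (Fin d × Fin d) ℂ) :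
    expect (entProj d) X = (d : ℂ)⁻¹ * ∑ i, ∑ j, X (i, i) (j, j) := by
  rw [expect_apply, Matrix.trace, Fintype.sum_prod_type]
  simp only [diag_apply, mul_apply, Fintype.sum_prod_type, entProj_apply, ite_and, ite_mul,
    zero_mul]
  simp only [Finset.sum_ite_eq, Finset.mem_univ, if_true, Finset.sum_ite_irrel,
    Finset.sum_const_zero, Finset.mul_sum]
  exact Finset.sum_comm

/-- The test of maximal entanglement succeeds with probability `1 / d²` if the first half has been
replaced by an independent state. -/
theorem expect_entProj_simulate {d : ℕ} (ω : State (Fin d)) :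
    expect (entProj d) (amplR (Fin d) (Protocol.simulate d ω) (entProj d)) =
      (d : ℂ)⁻¹ * (d : ℂ)⁻¹ := by
  have h : ∀ i j, amplR (Fin d) (Protocol.simulate d ω) (entProj d) (i, i) (j, j) =
      if i = j then (d : ℂ)⁻¹ * ω.mat i j else 0 := by
    intro i j
    simp only [amplR_apply, Protocol.simulate, LinearMap.smulRight_apply, traceLinearMap_apply,
      Matrix.smul_apply, smul_eq_mul, Matrix.trace, diag_apply, submatrix_apply, entProj_apply,
      ite_and]
    by_cases hij : i = j
    · simp [hij]
    · have : ∀ x : Fin d, (if x = i then if x = j then (d : ℂ)⁻¹ else 0 else 0) = 0 := by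
        intro x
        split_ifs with h1 h2
        · exact (hij (h1.symm.trans h2)).elim
        · rfl
        · rfl
      simp [hij, this]
  rw [expect_entProj]
  congr 1
  simp only [h, Finset.sum_ite_eq, Finset.mem_univ, if_true, ← Finset.mul_sum]
  have := ω.trace_one
  rw [Matrix.trace] at this
  simp only [diag_apply] at this
  rw [this, mul_one]

/-! ## The test of maximal entanglement on encoded systems -/

section

variable {d q : ℕ} (enc : Fin d ↪ Reg (Fin q))

/-- The isometry that encodes a system into qubits. -/
def encMat : Matrix (Reg (Fin q)) (Fin d) ℂ := Matrix.of fun s i => if s = enc i then 1 else 0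

theorem encode_eq_conjMap : encode enc = conjMap (encMat enc) := rfl

theorem encMat_conjTranspose_mul : (encMat enc)ᴴ * encMat enc = 1 := by
  ext i j
  simp [mul_apply, encMat, one_apply, eq_comm]

theorem isCP_encode : IsCP (encode enc) := isCP_conjMap _

theorem isTP_encode : IsTP (encode enc) := fun X => by
  rw [encode_eq_conjMap]
  simp only [conjMap, LinearMap.coe_mk, AddHom.coe_mk]
  rw [trace_mul_comm, ← Matrix.mul_assoc, encMat_conjTranspose_mul, Matrix.one_mul]

/-- The isometry that encodes two systems into two registers. -/
def encMatTwo : Matrix (Reg (Fin q ⊕ Fin q)) (Fin d × Fin d) ℂ :=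
  (encMat enc ⊗ₖ encMat enc).submatrix (joinReg (Fin q) (Fin q)).symm id

theorem encMatTwo_conjTranspose_mul : (encMatTwo enc)ᴴ * encMatTwo enc = 1 := by
  rw [encMatTwo, conjTranspose_submatrix, submatrix_mul_equiv, conjTranspose_kronecker,
    ← mul_kronecker_mul, encMat_conjTranspose_mul, one_kronecker_one, submatrix_id_id]

theorem maxEntVec_eq_mulVec : maxEntVec enc = encMatTwo enc *ᵥ entVec d := by
  funext s
  have h : ∀ i, (s = joinReg (Fin q) (Fin q) (enc i, enc i)) ↔
      ((joinReg (Fin q) (Fin q)).symm s).1 = enc i ∧ ((joinReg (Fin q) (Fin q)).symm s).2 = enc i :=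
    fun i => by rw [← Equiv.symm_apply_eq, Prod.ext_iff]
  simp only [maxEntVec, mulVec, dotProduct, Fintype.sum_prod_type, entVec, encMatTwo, encMat,
    submatrix_apply, kroneckerMap_apply, of_apply, id, h, mul_ite, mul_zero, Finset.sum_ite_eq,
    Finset.mem_univ, if_true, Finset.mul_sum, mul_one, ite_and]
  refine Finset.sum_congr rfl fun i _ => ?_
  split_ifs <;> simp

theorem maxEntVec_dotProduct (hd : 0 < d) : star (maxEntVec enc) ⬝ᵥ maxEntVec enc = 1 := by
  rw [maxEntVec_eq_mulVec, star_mulVec, dotProduct_mulVec, vecMul_vecMul,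
    encMatTwo_conjTranspose_mul, vecMul_one, entVec_dotProduct hd]

theorem maxEntProj_eq : vecMulVec (maxEntVec enc) (star (maxEntVec enc)) =
    encMatTwo enc * entProj d * (encMatTwo enc)ᴴ := by
  rw [maxEntVec_eq_mulVec, star_mulVec, entProj, mul_vecMulVec, vecMulVec_mul]

theorem isTP_maxEntTest : IsTP (maxEntTest enc) := fun X => by
  simp [maxEntTest, trace_diagonal, Matrix.sub_mul]

/-- Kraus operators are `|b⟩⟨s| Q_b`, with `Q_b` the projector of the outcome `b` and `s` running
over basis states. -/
theorem isCP_maxEntTest (hd : 0 < d) : IsCP (maxEntTest enc) := by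
  set P := vecMulVec (maxEntVec enc) (star (maxEntVec enc))
  have h1 : P * P = P := vecMulVec_mul_self (maxEntVec_dotProduct enc hd)
  have h2 : P.IsHermitian := (posSemidef_vecMulVec_self_star (maxEntVec enc)).isHermitian
  let Q : Bool → Matrix (Reg (Fin q ⊕ Fin q)) (Reg (Fin q ⊕ Fin q)) ℂ := fun b =>
    if b then P else 1 - P
  have hQ : ∀ b, Q b * Q b = Q b := by
    intro b
    cases b <;> simp [Q, Matrix.mul_sub, Matrix.sub_mul, h1]
  have hQ' : ∀ b, (Q b)ᴴ = Q b := by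
    intro b
    cases b <;> simp [Q, h2.eq]
  have key : maxEntTest enc = ∑ b : Bool, ∑ s : Reg (Fin q ⊕ Fin q),
      conjMap (single b s (1 : ℂ) * Q b) := by
    refine LinearMap.ext fun X => ?_
    have h3 : ∀ b s, conjMap (single b s (1 : ℂ) * Q b) X =
        single b b ((Q b * X * Q b) s s) := by
      intro b s
      simp only [conjMap, LinearMap.coe_mk, AddHom.coe_mk, conjTranspose_mul, hQ',
        conjTranspose_single, star_one]
      have : single b s (1 : ℂ) * Q b * X * (Q b * single s b (1 : ℂ)) =
          single b s (1 : ℂ) * (Q b * X * Q b) * single s b (1 : ℂ) := by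
        simp only [Matrix.mul_assoc]
      rw [this, single_mul_mul_single]
      simp
    have h4 : maxEntTest enc X = diagonal fun b => (Q b * X).trace := by
      refine congrArg diagonal (funext fun b => ?_)
      cases b <;> rfl
    rw [h4]
    simp only [LinearMap.sum_apply, h3]
    ext i j
    simp only [Matrix.sum_apply, trace_proj_mul (hQ _), single_apply, diagonal_apply]
    rw [Finset.sum_eq_single i]
    · by_cases hij : i = j
      · simp [hij, Matrix.trace]
      · simp [hij]
    · intro b _ hb
      simp [hb]
    · simp
  rw [key]
  exact IsCP.sum _ fun b => IsCP.sum _ fun s => isCP_conjMap _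

/-- The isometry `encMatTwo` carries `entProj` to the tested projector and cancels under the trace.
-/
theorem maxEntTest_encode (X Y : Matrix (Fin d) (Fin d) ℂ) :
    maxEntTest enc (relabel (joinReg (Fin q) (Fin q)) (encode enc X ⊗ₖ encode enc Y)) true true =
      expect (entProj d) (X ⊗ₖ Y) := by
  have h1 : relabel (joinReg (Fin q) (Fin q)) (encode enc X ⊗ₖ encode enc Y) =
      encMatTwo enc * (X ⊗ₖ Y) * (encMatTwo enc)ᴴ := by
    rw [encode_eq_conjMap, encMatTwo, conjTranspose_submatrix, conjTranspose_kronecker]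
    simp only [conjMap, LinearMap.coe_mk, AddHom.coe_mk, relabel_apply]
    rw [mul_kronecker_mul, mul_kronecker_mul]
    rfl
  have h2 : ∀ Z, maxEntTest enc Z true true =
      (vecMulVec (maxEntVec enc) (star (maxEntVec enc)) * Z).trace := fun Z => rfl
  rw [h2, h1, maxEntProj_eq, expect_apply]
  have h3 : ∀ A B : Matrix (Fin d × Fin d) (Fin d × Fin d) ℂ,
      encMatTwo enc * A * (encMatTwo enc)ᴴ * (encMatTwo enc * B * (encMatTwo enc)ᴴ) =
        encMatTwo enc * (A * B) * (encMatTwo enc)ᴴ := by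
    intro A B
    simp only [Matrix.mul_assoc]
    rw [← Matrix.mul_assoc (encMatTwo enc)ᴴ, encMatTwo_conjTranspose_mul, Matrix.one_mul]
  rw [h3, trace_mul_comm, ← Matrix.mul_assoc, encMatTwo_conjTranspose_mul, Matrix.one_mul]

end

/-! ## Message maps with an arbitrary resource -/

/-- The partial trace over the second factor. -/
def traceSnd (a b : Type*) [Fintype b] : OpMap (a × b) a :=
  ∑ k : b, submatrixMap fun i => (i, k)

theorem traceSnd_apply {a b : Type*} [Fintype b] (X : Matrix (a × b) (a × b) ℂ) (i j : a) :
    traceSnd a b X i j = ∑ k, X (i, k) (j, k) := by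
  simp only [traceSnd, LinearMap.sum_apply, Matrix.sum_apply]
  rfl

theorem traceSnd_kronecker {a b : Type*} [Fintype b] (X : Matrix a a ℂ) (Y : Matrix b b ℂ) :
    traceSnd a b (X ⊗ₖ Y) = Y.trace • X := by
  ext i j
  simp [traceSnd_apply, Matrix.trace, Finset.sum_mul, mul_comm (X i j)]

/-- No-signalling: what Bob does does not affect Alice's marginal. This is what makes his actual
input irrelevant to the attack. -/
theorem traceSnd_tensorMap {a b c e : Type*} [Fintype a] [DecidableEq a] [Fintype c]
    [DecidableEq c] [Fintype e] (Φ : OpMap a b) {Ψ : OpMap c e} (hΨ : IsTP Ψ)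
    (X : Matrix (a × c) (a × c) ℂ) :
    traceSnd b e (tensorMap Φ Ψ X) = Φ (traceSnd a c X) := by
  refine LinearMap.congr_fun (f := traceSnd b e ∘ₗ tensorMap Φ Ψ) (g := Φ ∘ₗ traceSnd a c)
    (linearMap_ext_kronecker fun X Y => ?_) X
  rw [LinearMap.comp_apply, LinearMap.comp_apply, tensorMap_kronecker, traceSnd_kronecker,
    traceSnd_kronecker, map_smul, hΨ]

section

variable {d ma mb : ℕ} {A B : Type*}

/-- The joint message map of the local maps `Φ` and `Ψ` with the resource operator `Z`. -/
def resourceMap (Φ : OpMap (Fin d × A) (Reg (Fin ma))) (Ψ : OpMap B (Reg (Fin mb)))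
    (Z : Matrix (A × B) (A × B) ℂ) : OpMap (Fin d) (Reg (Fin ma ⊕ Fin mb)) :=
  relabel (joinReg (Fin ma) (Fin mb)) ∘ₗ tensorMap Φ Ψ ∘ₗ
    relabel (Equiv.prodAssoc (Fin d) A B).symm ∘ₗ
    (Matrix.kroneckerBilinear (R := ℂ) (α := ℂ)).flip Z

theorem resourceMap_apply (Φ : OpMap (Fin d × A) (Reg (Fin ma))) (Ψ : OpMap B (Reg (Fin mb)))
    (Z : Matrix (A × B) (A × B) ℂ) (X : Matrix (Fin d) (Fin d) ℂ) :
    resourceMap Φ Ψ Z X = relabel (joinReg (Fin ma) (Fin mb)) (tensorMap Φ Ψ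
      (relabel (Equiv.prodAssoc (Fin d) A B).symm (X ⊗ₖ Z))) := rfl

theorem resourceMap_kronecker (Φ : OpMap (Fin d × A) (Reg (Fin ma))) (Ψ : OpMap B (Reg (Fin mb)))
    (Z : Matrix A A ℂ) (Z' : Matrix B B ℂ) (X : Matrix (Fin d) (Fin d) ℂ) :
    resourceMap Φ Ψ (Z ⊗ₖ Z') X =
      relabel (joinReg (Fin ma) (Fin mb)) (Φ (X ⊗ₖ Z) ⊗ₖ Ψ Z') := by
  rw [resourceMap_apply, ← tensorMap_kronecker]
  congr 2
  ext i j
  simp [relabel_apply, mul_assoc]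

/-- Bob's message is replaced by the state `τ`. -/
def replaceSnd (τ : Matrix (Reg (Fin mb)) (Reg (Fin mb)) ℂ) :
    OpMap (Reg (Fin ma ⊕ Fin mb)) (Reg (Fin ma ⊕ Fin mb)) :=
  relabel (joinReg (Fin ma) (Fin mb)) ∘ₗ
    (Matrix.kroneckerBilinear (R := ℂ) (α := ℂ)).flip τ ∘ₗ
    traceSnd (Reg (Fin ma)) (Reg (Fin mb)) ∘ₗ relabel (joinReg (Fin ma) (Fin mb)).symm

theorem replaceSnd_apply (τ : Matrix (Reg (Fin mb)) (Reg (Fin mb)) ℂ)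
    (X : Matrix (Reg (Fin ma ⊕ Fin mb)) (Reg (Fin ma ⊕ Fin mb)) ℂ) :
    replaceSnd τ X = relabel (joinReg (Fin ma) (Fin mb))
      (traceSnd (Reg (Fin ma)) (Reg (Fin mb)) (relabel (joinReg (Fin ma) (Fin mb)).symm X) ⊗ₖ τ) :=
  rfl

/-- If Bob's message is replaced by the one he would have sent on another input, then the resource
is effectively replaced by the product of its marginals. -/
theorem replaceSnd_comp_resourceMap [Fintype A] [DecidableEq A] [Fintype B] [DecidableEq B]
    (Φ : OpMap (Fin d × A) (Reg (Fin ma)))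
    {Ψ : OpMap B (Reg (Fin mb))} (Ψ' : OpMap B (Reg (Fin mb))) (hΨ : IsTP Ψ) (ρ : State (A × B)) :
    replaceSnd (Ψ' ρ.snd.mat) ∘ₗ resourceMap Φ Ψ ρ.mat =
      resourceMap Φ Ψ' (ρ.fst.mat ⊗ₖ ρ.snd.mat) := by
  refine LinearMap.ext fun X => ?_
  have h1 : relabel (joinReg (Fin ma) (Fin mb)).symm (resourceMap Φ Ψ ρ.mat X) =
      tensorMap Φ Ψ (relabel (Equiv.prodAssoc (Fin d) A B).symm (X ⊗ₖ ρ.mat)) :=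
    relabel_relabel_symm (joinReg (Fin ma) (Fin mb)).symm
      (tensorMap Φ Ψ (relabel (Equiv.prodAssoc (Fin d) A B).symm (X ⊗ₖ ρ.mat)))
  have h2 : traceSnd (Fin d × A) B (relabel (Equiv.prodAssoc (Fin d) A B).symm (X ⊗ₖ ρ.mat)) =
      X ⊗ₖ ρ.fst.mat := by
    ext i j
    simp [traceSnd_apply, relabel_apply, State.fst, Matrix.sum_apply, Finset.mul_sum]
  rw [LinearMap.comp_apply, replaceSnd_apply, h1, traceSnd_tensorMap Φ hΨ, h2,
    resourceMap_kronecker]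

/-- The rearrangement of systems that moves the reference to the end. -/
def refLast (a r c : Type*) : (a × r) × c ≃ (a × c) × r where
  toFun x := ((x.1.1, x.2), x.1.2)
  invFun x := ((x.1.1, x.2), x.1.2)
  left_inv _ := rfl
  right_inv _ := rfl

/-- The fidelity of the maximally entangled state with its image under the message map with
resource `Z`, followed by the decoder `D`. -/
noncomputable def fidelityWith (Φ : OpMap (Fin d × A) (Reg (Fin ma))) (Ψ : OpMap B (Reg (Fin mb)))
    (D : OpMap (Reg (Fin ma ⊕ Fin mb)) (Fin d)) : Matrix (A × B) (A × B) ℂ →ₗ[ℂ] ℂ :=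
  expect (entProj d) ∘ₗ
    amplR (Fin d) (D ∘ₗ relabel (joinReg (Fin ma) (Fin mb)) ∘ₗ tensorMap Φ Ψ ∘ₗ
      relabel (Equiv.prodAssoc (Fin d) A B).symm) ∘ₗ
    relabel (refLast (Fin d) (Fin d) (A × B)) ∘ₗ
    Matrix.kroneckerBilinear (R := ℂ) (α := ℂ) (entProj d)

theorem fidelityWith_apply (Φ : OpMap (Fin d × A) (Reg (Fin ma))) (Ψ : OpMap B (Reg (Fin mb)))
    (D : OpMap (Reg (Fin ma ⊕ Fin mb)) (Fin d)) (Z : Matrix (A × B) (A × B) ℂ) :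
    fidelityWith Φ Ψ D Z =
      expect (entProj d) (amplR (Fin d) (D ∘ₗ resourceMap Φ Ψ Z) (entProj d)) := by
  have h : relabel (refLast (Fin d) (Fin d) (A × B)) (entProj d ⊗ₖ Z) =
      amplR (Fin d) ((Matrix.kroneckerBilinear (R := ℂ) (α := ℂ)).flip Z) (entProj d) := rfl
  change expect (entProj d) (amplR (Fin d) _ (relabel _ (entProj d ⊗ₖ Z))) = _
  rw [h]
  rfl

/-- The resource enters as an input: a fixed channel acts on `entProj ⊗ Z`, followed by a projective
test. Hence `fidelityWith` is the outcome probability of a measurement on `AB`. -/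
theorem fidelityWith_bounds [Fintype A] [Fintype B] (hd : 0 < d)
    {Φ : OpMap (Fin d × A) (Reg (Fin ma))}
    {Ψ : OpMap B (Reg (Fin mb))} {D : OpMap (Reg (Fin ma ⊕ Fin mb)) (Fin d)}
    (hΦ : IsCP Φ) (hΦ' : IsTP Φ) (hΨ : IsCP Ψ) (hΨ' : IsTP Ψ) (hD : IsCP D) (hD' : IsTP D)
    {Z : Matrix (A × B) (A × B) ℂ} (hZ : Z.PosSemidef) :
    0 ≤ fidelityWith Φ Ψ D Z ∧ fidelityWith Φ Ψ D Z ≤ Z.trace := by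
  set Θ := amplR (Fin d) (D ∘ₗ relabel (joinReg (Fin ma) (Fin mb)) ∘ₗ tensorMap Φ Ψ ∘ₗ
      relabel (Equiv.prodAssoc (Fin d) A B).symm) ∘ₗ
    relabel (refLast (Fin d) (Fin d) (A × B)) with hΘ
  have h1 : IsCP Θ := ((hD.comp ((isCP_relabel _).comp ((isCP_tensorMap hΦ hΨ).comp
    (isCP_relabel _)))).amplR _).comp (isCP_relabel _)
  have h2 : IsTP Θ := ((hD'.comp ((isTP_relabel _).comp ((isTP_tensorMap hΦ' hΨ').comp
    (isTP_relabel _)))).amplR _).comp (isTP_relabel _)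
  have h3 := expect_entProj_bounds hd (h1.posSemidef ((posSemidef_entProj d).kronecker hZ))
  rw [h2, trace_kronecker, trace_entProj hd, one_mul] at h3
  exact h3

end

/-! ## The distinguishing algorithm -/

section

variable {d q ma mb : ℕ}

/-- The wires of the message and of a reference of `q + mb` qubits: the decoder acts on Alice's
message and on the last `mb` qubits of the reference, and Bob's message is discarded. -/
def attackWires (ma mb q : ℕ) :
    ((Fin ma ⊕ Fin mb) ⊕ Fin q) ⊕ Fin mb ≃ (Fin ma ⊕ Fin mb) ⊕ Fin (q + mb) where
  toFun := Sum.elim (Sum.elim (Sum.elim (fun i => Sum.inl (Sum.inl i))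
    fun j => Sum.inr (finSumFinEquiv (Sum.inr j))) fun k => Sum.inr (finSumFinEquiv (Sum.inl k)))
    fun j => Sum.inl (Sum.inr j)
  invFun := Sum.elim (Sum.elim (fun i => Sum.inl (Sum.inl (Sum.inl i))) Sum.inr) fun w =>
    Sum.elim (fun k => Sum.inl (Sum.inr k)) (fun j => Sum.inl (Sum.inl (Sum.inr j)))
      (finSumFinEquiv.symm w)
  left_inv := by rintro (((i | j) | k) | j) <;> simp
  right_inv := by
    rintro ((i | j) | w)
    · rfl
    · rfl
    · obtain ⟨w | w, rfl⟩ := finSumFinEquiv.surjective w <;> simp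

/-- The joint register of `q` and `mb` qubits. -/
def refReg (q mb : ℕ) : Reg (Fin q) × Reg (Fin mb) ≃ Reg (Fin (q + mb)) :=
  (joinReg (Fin q) (Fin mb)).trans (finSumFinEquiv.arrowCongr (Equiv.refl Bool))

/-- The second half of a joint state is encoded into qubits, and the state `τ` is appended. -/
def prepareInput (enc : Fin d ↪ Reg (Fin q)) (τ : Matrix (Reg (Fin mb)) (Reg (Fin mb)) ℂ) :
    OpMap (Fin d × Fin d) (Fin d × Reg (Fin (q + mb))) :=
  relabel ((Equiv.prodAssoc (Fin d) (Reg (Fin q)) (Reg (Fin mb))).trans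
    ((Equiv.refl (Fin d)).prodCongr (refReg q mb))) ∘ₗ
  (Matrix.kroneckerBilinear (R := ℂ) (α := ℂ)).flip τ ∘ₗ amplL (Fin d) (encode enc)

theorem prepareInput_apply (enc : Fin d ↪ Reg (Fin q))
    (τ : Matrix (Reg (Fin mb)) (Reg (Fin mb)) ℂ) (X : Matrix (Fin d × Fin d) (Fin d × Fin d) ℂ) :
    prepareInput enc τ X = relabel ((Equiv.prodAssoc (Fin d) (Reg (Fin q)) (Reg (Fin mb))).trans
      ((Equiv.refl (Fin d)).prodCongr (refReg q mb))) (amplL (Fin d) (encode enc) X ⊗ₖ τ) := rfl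

theorem prepareInput_kronecker (enc : Fin d ↪ Reg (Fin q))
    (τ : Matrix (Reg (Fin mb)) (Reg (Fin mb)) ℂ) (X Y : Matrix (Fin d) (Fin d) ℂ) :
    prepareInput enc τ (X ⊗ₖ Y) = X ⊗ₖ relabel (refReg q mb) (encode enc Y ⊗ₖ τ) := by
  rw [prepareInput_apply, amplL_kronecker]
  ext ⟨i, k⟩ ⟨j, l⟩
  simp [relabel_apply, mul_assoc]

/-- The substitution of Bob's message is pure rewiring once `τ` is stored in the reference. -/
theorem traceOut_attackWires (X : Matrix (Reg (Fin ma ⊕ Fin mb)) (Reg (Fin ma ⊕ Fin mb)) ℂ)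
    (Y : Matrix (Reg (Fin q)) (Reg (Fin q)) ℂ) (τ : Matrix (Reg (Fin mb)) (Reg (Fin mb)) ℂ) :
    relabel (joinReg (Fin ma ⊕ Fin mb) (Fin q)).symm (traceOut (attackWires ma mb q)
      (relabel (joinReg (Fin ma ⊕ Fin mb) (Fin (q + mb)))
        (X ⊗ₖ relabel (refReg q mb) (Y ⊗ₖ τ)))) = replaceSnd τ X ⊗ₖ Y := by
  have h : ∀ (s : Reg (Fin ma ⊕ Fin mb)) (u : Reg (Fin q)) (m : Reg (Fin mb)),
      (splitReg (attackWires ma mb q)).symm (joinReg _ _ (s, u), m) =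
        joinReg _ _ (Sum.elim (s ∘ Sum.inl) m, refReg q mb (u, s ∘ Sum.inr)) := by
    intro s u m
    funext w
    rcases w with (i | j) | w
    · rfl
    · rfl
    · obtain ⟨w | w, rfl⟩ := finSumFinEquiv.surjective w <;>
        simp [splitReg, attackWires, joinReg, refReg, Equiv.arrowCongr]
  ext ⟨s, u⟩ ⟨t, v⟩
  have h₁ : (replaceSnd τ X ⊗ₖ Y) (s, u) (t, v) =
      traceSnd _ _ (relabel (joinReg (Fin ma) (Fin mb)).symm X) (s ∘ Sum.inl) (t ∘ Sum.inl) *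
        τ (s ∘ Sum.inr) (t ∘ Sum.inr) * Y u v := rfl
  rw [h₁, traceSnd_apply, Finset.sum_mul, Finset.sum_mul]
  refine (traceOut_apply _ _ _ _).trans (Finset.sum_congr rfl fun m _ => ?_)
  rw [Equiv.symm_symm, h, h]
  simp only [relabel_apply, submatrix_apply, Equiv.symm_apply_apply, kroneckerMap_apply,
    Equiv.symm_symm]
  rw [mul_assoc, mul_comm (Y u v)]
  rfl

/-- Connects the circuit-level attack with the entanglement fidelity of `D` after the substitution.
Both sides are linear in `X`, so products suffice. -/
theorem decodeAndTest_prepareInput (enc : Fin d ↪ Reg (Fin q))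
    (τ : Matrix (Reg (Fin mb)) (Reg (Fin mb)) ℂ) (Φ : OpMap (Fin d) (Reg (Fin ma ⊕ Fin mb)))
    (D : OpMap (Reg (Fin ma ⊕ Fin mb)) (Fin d)) (X : Matrix (Fin d × Fin d) (Fin d × Fin d) ℂ) :
    decodeAndTest (attackWires ma mb q) (encode enc ∘ₗ D) (maxEntTest enc)
      (relabel (joinReg (Fin ma ⊕ Fin mb) (Fin (q + mb)))
        (amplR (Reg (Fin (q + mb))) Φ (prepareInput enc τ X))) true true =
      expect (entProj d) (amplR (Fin d) (D ∘ₗ replaceSnd τ ∘ₗ Φ) X) := by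
  let ev : Matrix Bool Bool ℂ →ₗ[ℂ] ℂ := Matrix.entryLinearMap ℂ ℂ true true
  refine LinearMap.congr_fun (f := ev ∘ₗ
    decodeAndTest (attackWires ma mb q) (encode enc ∘ₗ D) (maxEntTest enc) ∘ₗ
      relabel (joinReg (Fin ma ⊕ Fin mb) (Fin (q + mb))) ∘ₗ
        amplR (Reg (Fin (q + mb))) Φ ∘ₗ prepareInput enc τ)
    (g := expect (entProj d) ∘ₗ amplR (Fin d) (D ∘ₗ replaceSnd τ ∘ₗ Φ))
    (linearMap_ext_kronecker fun X Y => ?_) X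
  change decodeAndTest (attackWires ma mb q) (encode enc ∘ₗ D) (maxEntTest enc)
      (relabel (joinReg (Fin ma ⊕ Fin mb) (Fin (q + mb)))
        (amplR (Reg (Fin (q + mb))) Φ (prepareInput enc τ (X ⊗ₖ Y)))) true true =
      expect (entProj d) (amplR (Fin d) (D ∘ₗ replaceSnd τ ∘ₗ Φ) (X ⊗ₖ Y))
  rw [prepareInput_kronecker, amplR_kronecker, amplR_kronecker, decodeAndTest]
  simp only [LinearMap.comp_apply]
  rw [traceOut_attackWires, amplR_kronecker, ← maxEntTest_encode]
  rfl

/-- The algorithm that decodes with `D` and tests maximal entanglement with the reference. -/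
noncomputable def attack (hd : 0 < d) (enc : Fin d ↪ Reg (Fin q))
    (D : Channel (Reg (Fin ma ⊕ Fin mb)) (Fin d)) :
    Algorithm ((Fin ma ⊕ Fin mb) ⊕ Fin (q + mb)) where
  map := decodeAndTest (attackWires ma mb q) (encode enc ∘ₗ D.map) (maxEntTest enc)
  completelyPositive := ((isCP_maxEntTest enc hd).comp (isCP_relabel _)).comp
    ((((isCP_encode enc).comp D.isCP).amplR _).comp ((isCP_relabel _).comp (isCP_traceOut _)))
  tracePreserving := ((isTP_maxEntTest enc).comp (isTP_relabel _)).comp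
    ((((isTP_encode enc).comp D.isTP).amplR _).comp ((isTP_relabel _).comp (isTP_traceOut _)))
  classical _ := isDiag_diagonal _

/-- The input of the attack: a maximally entangled state of the secret and encoded reference
qubits, and a reference register in the state `τ`. -/
noncomputable def attackInput (hd : 0 < d) (enc : Fin d ↪ Reg (Fin q))
    (τ : State (Reg (Fin mb))) : State (Fin d × Reg (Fin (q + mb))) where
  mat := prepareInput enc τ.mat (entProj d)
  posSemidef := (isCP_relabel _).posSemidef
    ((((isCP_encode enc).amplL _).posSemidef (posSemidef_entProj d)).kronecker τ.posSemidef)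
  trace_one := by
    rw [prepareInput_apply, isTP_relabel, trace_kronecker, (isTP_encode enc).amplL (Fin d),
      trace_entProj hd, τ.trace_one, one_mul]

/-- The state obtained by applying a channel. -/
def Channel.apply {a b : Type*} [Fintype a] [DecidableEq a] [Fintype b] [DecidableEq b]
    (Φ : Channel a b) (ρ : State a) : State b where
  mat := Φ.map ρ.mat
  posSemidef := Φ.isCP.posSemidef ρ.posSemidef
  trace_one := by rw [Φ.tracePreserving, ρ.trace_one]

/-- Whatever is computed from a message independent of the secret is independent of it too, so
`expect_entProj_simulate` applies. -/
theorem replaceSnd_comp_simulate (D : Channel (Reg (Fin ma ⊕ Fin mb)) (Fin d))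
    (τ : State (Reg (Fin mb))) (σ : State (Reg (Fin ma ⊕ Fin mb))) :
    ∃ ω : State (Fin d), D.map ∘ₗ replaceSnd τ.mat ∘ₗ Protocol.simulate d σ =
      Protocol.simulate d ω := by
  let σ' : State (Reg (Fin ma) × Reg (Fin mb)) :=
    { mat := relabel (joinReg (Fin ma) (Fin mb)).symm σ.mat
      posSemidef := (isCP_relabel _).posSemidef σ.posSemidef
      trace_one := by rw [isTP_relabel, σ.trace_one] }
  have hσ : traceSnd (Reg (Fin ma)) (Reg (Fin mb)) (relabel (joinReg (Fin ma) (Fin mb)).symm σ.mat)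
      = σ'.fst.mat := by
    ext i j
    rw [traceSnd_apply]
    simp only [State.fst, Matrix.sum_apply, submatrix_apply]
    rfl
  let κ : State (Reg (Fin ma ⊕ Fin mb)) :=
    { mat := replaceSnd τ.mat σ.mat
      posSemidef := by
        rw [replaceSnd_apply, hσ]
        exact (isCP_relabel _).posSemidef (σ'.fst.posSemidef.kronecker τ.posSemidef)
      trace_one := by
        rw [replaceSnd_apply, hσ, isTP_relabel, trace_kronecker, σ'.fst.trace_one, τ.trace_one,
          one_mul] }
  refine ⟨D.apply κ, LinearMap.ext fun X => ?_⟩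
  simp only [LinearMap.comp_apply, Protocol.simulate, LinearMap.smulRight_apply, map_smul]
  rfl

end

-- Fidelity on the 1-input, and the conclusion

/-- On the input on which the secret can be recovered, the fidelity is at least `1 - ε`. -/
theorem one_sub_fidelityWith_le {d ma mb : ℕ} (hd : 0 < d) {A B : Type*} [Fintype A]
    [DecidableEq A] [Fintype B] [DecidableEq B] {Φ : OpMap (Fin d × A) (Reg (Fin ma))}
    {Ψ : OpMap B (Reg (Fin mb))} {D : OpMap (Reg (Fin ma ⊕ Fin mb)) (Fin d)}
    {Z : Matrix (A × B) (A × B) ℂ} {ε : ℝ} (hC : IsCP (D ∘ₗ resourceMap Φ Ψ Z))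
    (h : diamondDist (D ∘ₗ resourceMap Φ Ψ Z) LinearMap.id ≤ (ε : EReal)) :
    0 ≤ ε ∧ 1 - (fidelityWith Φ Ψ D Z).re ≤ ε := by
  let ψ : State (Fin d × Fin d) := ⟨entProj d, posSemidef_entProj d, trace_entProj hd⟩
  have h1 := (le_iSup₂ (f := fun (r : ℕ) (ψ : State (Fin d × Fin r)) =>
    ((traceNorm (amplR (Fin r) (D ∘ₗ resourceMap Φ Ψ Z) ψ.mat -
      amplR (Fin r) LinearMap.id ψ.mat) : ℝ) : EReal)) d ψ).trans h
  rw [EReal.coe_le_coe_iff] at h1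
  refine ⟨(traceNorm_nonneg _).trans h1, ?_⟩
  have hid : amplR (Fin d) LinearMap.id ψ.mat = entProj d := rfl
  have hH : (amplR (Fin d) (D ∘ₗ resourceMap Φ Ψ Z) ψ.mat - entProj d).IsHermitian :=
    (hC.amplR_posSemidef ψ.posSemidef).1.sub ψ.posSemidef.1
  rw [hid] at h1
  have h2 := (abs_re_le_traceNorm hH (expect (entProj d))
    fun X hX => expect_entProj_bounds hd hX).trans h1
  have h3 : expect (entProj d) (entProj d) = 1 := by
    rw [expect_apply, entProj_mul_self hd, trace_entProj hd]
  rw [map_sub, h3, Complex.sub_re, Complex.one_re] at h2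
  rw [fidelityWith_apply]
  have := (abs_le.1 h2).1
  linarith

theorem isCP_resourceMap {d ma mb : ℕ} {A B : Type*} [Fintype A] [Fintype B]
    [DecidableEq A] [DecidableEq B]
    {Φ : OpMap (Fin d × A) (Reg (Fin ma))} {Ψ : OpMap B (Reg (Fin mb))} (hΦ : IsCP Φ)
    (hΨ : IsCP Ψ) {Z : Matrix (A × B) (A × B) ℂ} (hZ : Z.PosSemidef) :
    IsCP (resourceMap Φ Ψ Z) := by
  refine (isCP_relabel _).comp ((isCP_tensorMap hΦ hΨ).comp ((isCP_relabel _).comp ?_))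
  exact fun r X hX => (isCP_relabel (refLast (Fin d) (Fin r) (A × B))).posSemidef (hX.kronecker hZ)

theorem exists_inputs_of_ne {n : ℕ} {f : (Fin n → Bool) → (Fin n → Bool) → Bool}
    (hf : ∃ x y y', f x y ≠ f x y') : ∃ x y₀ y₁, f x y₀ = false ∧ f x y₁ = true := by
  obtain ⟨x, y, y', h⟩ := hf
  cases hy : f x y <;> cases hy' : f x y'
  · simp_all
  · exact ⟨x, y, y', hy, hy'⟩
  · exact ⟨x, y', y, hy', hy⟩
  · simp_all

theorem inv_mul_inv_le_one_div_sqrt {d : ℕ} (hd : 0 < d) :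
    (d : ℝ)⁻¹ * (d : ℝ)⁻¹ ≤ 1 / √(d : ℝ) := by
  have h1 : (1 : ℝ) ≤ d := by exact_mod_cast hd
  have h2 : √(d : ℝ) ≤ d := Real.sqrt_le_iff.2 ⟨by linarith, by nlinarith⟩
  have h3 : 0 < √(d : ℝ) := Real.sqrt_pos.2 (by linarith)
  calc (d : ℝ)⁻¹ * (d : ℝ)⁻¹ ≤ 1 * (d : ℝ)⁻¹ := by
        gcongr
        exact inv_le_one_of_one_le₀ h1
    _ ≤ 1 / √(d : ℝ) := by
        rw [one_mul, one_div]
        gcongr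

end CDQS

theorem theorem1 {n d q ma mb : ℕ} (hd : 0 < d)
    {A B : Type*} [Fintype A] [DecidableEq A] [Fintype B] [DecidableEq B]
    (f : (Fin n → Bool) → (Fin n → Bool) → Bool)
    (hf : ∃ x y y', f x y ≠ f x y')
    (G : CDQS.GateSet) (enc : Fin d ↪ CDQS.Reg (Fin q))
    (κ κD κT : ℝ) (hκ : κD + κT ≤ κ) (s t : ℕ)
    (ht : (s : ℕ∞) + CDQS.algComplexity G κT (CDQS.maxEntTest enc) ≤ (t : ℕ∞))
    (ε δ : ℝ) (P : CDQS.Protocol n d ma mb A B)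
    (hcorrect : P.IsCorrect G enc κD s f ε)
    (hsecure : P.IsSecure G κ t f δ) :
    -Real.log (1 / √(d : ℝ) + δ + ε) - 1 ≤ P.resource.mutualInfo := by
  open CDQS Matrix in
  obtain ⟨x, y₀, y₁, h₀, h₁⟩ := exists_inputs_of_ne hf
  obtain ⟨D, hDs, hDε⟩ := hcorrect x y₁ h₁
  obtain ⟨σ, hσ⟩ := hsecure x y₀ h₀
  have hCP : IsCP (D.map ∘ₗ resourceMap (P.alice x).map (P.bob y₁).map P.resource.mat) :=
    D.isCP.comp (isCP_resourceMap (P.alice x).isCP (P.bob y₁).isCP P.resource.posSemidef)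
  obtain ⟨hε, hp₁⟩ := one_sub_fidelityWith_le hd hCP hDε
  -- Bob's message on `y₁`, made from his marginal alone. Security allows every reference state, so
  -- `τ` serves as free quantum advice.
  let τ := (P.bob y₁).apply P.resource.snd
  have hcomplexity : algComplexity G κ (attack hd enc D).map ≤ (t : ℕ∞) :=
    (algComplexity_decodeAndTest_le G hκ (attackWires ma mb q)
      ((isCP_encode enc).comp D.isCP) (isCP_maxEntTest enc hd) (isTP_maxEntTest enc)).trans
      ((add_le_add_left hDs _).trans ht)
  have hdist : |(attack hd enc D).prob (relabel (joinReg _ _) (amplR _ (Protocol.simulate d σ)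
        (attackInput hd enc τ).mat)) -
      (attack hd enc D).prob (relabel (joinReg _ _) (amplR _ (P.messageMap x y₀)
        (attackInput hd enc τ).mat))| ≤ δ := by
    rw [← EReal.coe_le_coe_iff]
    refine le_trans ?_ hσ
    refine le_trans ?_ (le_iSup₂ (f := fun (r : ℕ) (ψ : State (Fin d × Reg (Fin r))) =>
      compDist G κ t (relabel (joinReg _ (Fin r)) (amplR (Reg (Fin r)) (Protocol.simulate d σ)
        ψ.mat)) (relabel (joinReg _ (Fin r)) (amplR (Reg (Fin r)) (P.messageMap x y₀) ψ.mat)))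
      (q + mb) (attackInput hd enc τ))
    exact le_iSup₂ (f := fun (𝒜 : Algorithm ((Fin ma ⊕ Fin mb) ⊕ Fin (q + mb)))
      (_ : algComplexity G κ 𝒜.map ≤ (t : ℕ∞)) => ((|𝒜.prob _ - 𝒜.prob _| : ℝ) : EReal))
      (attack hd enc D) hcomplexity
  obtain ⟨ω, hω⟩ := replaceSnd_comp_simulate D τ σ
  have hsim : (attack hd enc D).prob (relabel (joinReg _ _) (amplR _ (Protocol.simulate d σ)
      (attackInput hd enc τ).mat)) = (d : ℝ)⁻¹ * (d : ℝ)⁻¹ := by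
    have h := decodeAndTest_prepareInput enc τ.mat (Protocol.simulate d σ) D.map (entProj d)
    rw [hω, expect_entProj_simulate] at h
    refine (congrArg Complex.re h).trans ?_
    rw [← Complex.ofReal_natCast, ← Complex.ofReal_inv, ← Complex.ofReal_mul, Complex.ofReal_re]
  have hreal : (attack hd enc D).prob (relabel (joinReg _ _) (amplR _ (P.messageMap x y₀)
      (attackInput hd enc τ).mat)) = (fidelityWith (P.alice x).map (P.bob y₁).map D.map
        (P.resource.fst.mat ⊗ₖ P.resource.snd.mat)).re := by
    have h := decodeAndTest_prepareInput enc τ.mat (P.messageMap x y₀) D.map (entProj d)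
    -- `P.messageMap x y₀` unfolds to `resourceMap` with the resource `Ψ`; the substitution turns
    -- `y₀` into `y₁` and `Ψ` into `Ψ_A ⊗ Ψ_B`.
    have h' : replaceSnd τ.mat ∘ₗ P.messageMap x y₀ = _ :=
      replaceSnd_comp_resourceMap (P.alice x).map (P.bob y₁).map (P.bob y₀).isTP P.resource
    rw [h', ← fidelityWith_apply] at h
    exact congrArg Complex.re h
  rw [hsim, hreal] at hdist
  -- The signs of `δ` and `ε` are not assumed; they follow from the distances they bound, and make
  -- the argument of the logarithm positive.
  have hδ : 0 ≤ δ := (abs_nonneg _).trans hdist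
  have hd' := inv_mul_inv_le_one_div_sqrt hd
  have hpos : 0 < 1 / √(d : ℝ) := one_div_pos.2 (Real.sqrt_pos.2 (by exact_mod_cast hd))
  refine P.resource.neg_log_sub_one_le_mutualInfo
    (g := fidelityWith (P.alice x).map (P.bob y₁).map D.map)
    (fun X hX => fidelityWith_bounds hd (P.alice x).isCP (P.alice x).isTP (P.bob y₁).isCP
      (P.bob y₁).isTP D.isCP D.isTP hX) (by positivity) ?_
  have := (abs_le.1 hdist).1
  linarith
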